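/- Let $p\ge 1$ and $n\ge p+1$ be integers and let $q$ be a real number with $2q+np>2$. For $\mathrm{Re}(\mu-\kappa)>-\frac12$ and $|\arg z|<\pi$ let $$W_{\kappa,\mu}(z)=\frac{z^{\kappa}e^{-z/2}}{\Gamma(\mu-\kappa+\frac12)}\int_0^\infty t^{\mu-\kappa-\frac12}e^{-t}\Bigl(1+\frac tz\Bigr)^{\mu+\kappa-\frac12}\,dt$$ be the Whittaker function (principal powers), and for $\mathrm{Re}(a)>\frac{p-1}2$ let $$\Gamma_p(a)=\int_{A>0}e^{-\mathrm{tr}A}\,|A|^{a-\frac{p+1}2}\,(dA)$$ be the multivariate gamma function. Here $|\cdot|$ is the determinant, and integrals over $X>0$ run over the real symmetric positive definite $p\times p$ matrices with respect to Lebesgue measure $(dX)=\prod_{i\le j}dx_{ij}$. The M-Varma transform with parameter $q$ of a function $\phi$ of a positive definite $p\times p$ matrix is $$V_\phi(Z)=\int_{X>0}\bigl[\mathrm{tr}\,ZX\bigr]^{\frac{2q+p-4}4}\,e^{-\frac12\mathrm{tr}(ZX)}\,W_{\alpha,\beta}(\mathrm{tr}\,ZX)\,\phi(X)\,(dX),\qquad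 \alpha=\frac{2q-p}4,\quad \beta=\frac{2q+p-2}4 .$$ Let $\phi_1(X)=|X|^{\frac{n-1}2-\frac{p+1}2}$. Then for every complex symmetric $p\times p$ matrix $Z$ with positive definite real part, the integral defining $V_{\phi_1}(Z)$ converges absolutely, and $$V_{\phi_1}(Z)=\frac{\Gamma\!\left(\frac{2q+np-2}2\right)\Gamma_p\!\left(\frac{n-1}2\right)}{\Gamma\!\left(\frac{np}2\right)}\;|Z|^{-\frac{n-1}2}.$$ Here $|Z|^{s}$ denotes the product of the principal powers $\lambda^{s}$ over the eigenvalues $\lambda$ of $Z$ with multiplicity (they all have positive real part); this is the branch of $(\det Z)^s$ that is continuous on the set of complex symmetric matrices with positive definite real part and agrees with the usual power for real $Z>0$. -/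

import Mathlib

open MeasureTheory

namespace MVarma

noncomputable section

/-- Index set of the independent entries `x_{ij}`, `i ≤ j`, of a symmetric `p × p` matrix. -/
abbrev UpperIndex (p : ℕ) : Type := {ij : Fin p × Fin p // ij.1 ≤ ij.2}

/-- The real symmetric matrix whose entries on and above the diagonal are given by `x`. -/
def symMatrix {p : ℕ} (x : UpperIndex p → ℝ) : Matrix (Fin p) (Fin p) ℝ :=
  Matrix.of fun i j => x ⟨(min i j, max i j), min_le_max⟩

/-- The cone `X > 0` of positive definite matrices, in the coordinates `x_{ij}`, `i ≤ j`. -/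
def posDefCone (p : ℕ) : Set (UpperIndex p → ℝ) := {x | (symMatrix x).PosDef}

/-- `∫_{X > 0} f(X) (dX)`, where `(dX) = ∏_{i ≤ j} dx_{ij}` is Lebesgue measure. -/
def coneIntegral {p : ℕ} (f : Matrix (Fin p) (Fin p) ℝ → ℂ) : ℂ :=
  ∫ x in posDefCone p, f (symMatrix x)

/-- Absolute convergence of `∫_{X > 0} f(X) (dX)`. -/
def ConeIntegrable {p : ℕ} (f : Matrix (Fin p) (Fin p) ℝ → ℂ) : Prop :=
  IntegrableOn (fun x => f (symMatrix x)) (posDefCone p)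

/-- `etr(A) = exp(tr A)`. -/
def etr {p : ℕ} (A : Matrix (Fin p) (Fin p) ℂ) : ℂ := Complex.exp A.trace

/-- A real matrix regarded as a complex matrix. -/
def toComplex {p : ℕ} (X : Matrix (Fin p) (Fin p) ℝ) : Matrix (Fin p) (Fin p) ℂ :=
  X.map Complex.ofReal

/-- The multivariate gamma function
`Γ_p(a) = ∫_{A > 0} etr(-A) |A|^{a - (p+1)/2} (dA)`, for `Re a > (p-1)/2`. -/
def multivariateGamma (p : ℕ) (a : ℂ) : ℂ :=
  coneIntegral (p := p) fun A => etr (-toComplex A) * (A.det : ℂ) ^ (a - ((p : ℂ) + 1) / 2)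

/-- The Whittaker function `W_{κ,μ}(z)`, for `Re (μ - κ) > -1/2` and `|arg z| < π`; all powers
are principal. -/
def whittakerW (κ μ z : ℂ) : ℂ :=
  z ^ κ * Complex.exp (-z / 2) / Complex.Gamma (μ - κ + 1 / 2) *
    ∫ t in Set.Ioi (0 : ℝ),
      (t : ℂ) ^ (μ - κ - 1 / 2) * Complex.exp (-(t : ℂ)) * (1 + (t : ℂ) / z) ^ (μ + κ - 1 / 2)

/-- The kernel `(tr ZX)^{(2q+p-4)/4} etr(-ZX/2) W_{α,β}(tr ZX)` with `α = (2q-p)/4` and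
`β = (2q+p-2)/4`. -/
def varmaKernel {p : ℕ} (q : ℝ) (Z : Matrix (Fin p) (Fin p) ℂ)
    (X : Matrix (Fin p) (Fin p) ℝ) : ℂ :=
  (Z * toComplex X).trace ^ ((2 * (q : ℂ) + p - 4) / 4) *
    etr (-(1 / 2 : ℂ) • (Z * toComplex X)) *
    whittakerW ((2 * (q : ℂ) - p) / 4) ((2 * (q : ℂ) + p - 2) / 4) (Z * toComplex X).trace

/-- Absolute convergence at `Z` of the integral defining the M-Varma transform of `φ`. -/
def VarmaConvergent {p : ℕ} (q : ℝ) (φ : Matrix (Fin p) (Fin p) ℝ → ℂ)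
    (Z : Matrix (Fin p) (Fin p) ℂ) : Prop :=
  ConeIntegrable fun X => varmaKernel q Z X * φ X

/-- The M-Varma transform of `φ` at `Z`. -/
def varmaTransform {p : ℕ} (q : ℝ) (φ : Matrix (Fin p) (Fin p) ℝ → ℂ)
    (Z : Matrix (Fin p) (Fin p) ℂ) : ℂ :=
  coneIntegral fun X => varmaKernel q Z X * φ X

/-- The power `|Z|^s` of the determinant, `∏ λ^s` over the eigenvalues `λ` of `Z` with algebraic
multiplicity, each power being principal. If `Z` is complex symmetric with `Re Z > 0`, then all
eigenvalues lie in the open right half-plane, and this is the branch of `(det Z)^s` that is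
continuous (indeed holomorphic) on that domain and positive for real `Z > 0` and real `s`. The
principal power of the number `det Z` is a different, discontinuous function when `p ≥ 3`. -/
def detPow {p : ℕ} (Z : Matrix (Fin p) (Fin p) ℂ) (s : ℂ) : ℂ :=
  (Z.charpoly.roots.map fun l => l ^ s).prod

end

end MVarma

/-! Put n = N + 1 and z = tr ZX. Absorbing the powers of z into 1 + t/z merges all factors of the
kernel: Γ(p/2) times the kernel is ∫ t^(p/2-1) e^(-(z+t)) (z+t)^(q-1) dt over t > 0
(`cpow_mul_exp_mul_whittakerW`). Hence Γ(p/2) V(Z) is an integral over pairs (X, t) of a homogeneous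
weight against e^(-Λ) Λ^(q-1), where Λ = tr ZX + t is linear. The degree of the weight plus the
dimension of the space is M = np/2.

For such a weight φ, Γ(M) ∫ φ e^(-Λ) Λ^σ = Γ(M+σ) ∫ φ e^(-Λ) (`integral_homogeneous_mul_cpow`). As Λ
is complex, its level sets are not available. Instead the integrand is averaged over dilations u
with u ≤ Re Λ ≤ 2u against du/u, and x is rescaled by u. The u-integral becomes a complex gamma
integral, and what remains is an integral over the shell 1 ≤ Re Λ ≤ 2 that does not depend on σ.

With σ = q - 1 there is left Γ(p/2) times the Laplace transform of |X|^(N/2-(p+1)/2), which is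
Γ_p(N/2) |Z|^(-N/2) (`coneIntegral_laplaceIntegrand`). To see this, split off the first row and
column of X: the corner gives a gamma integral, the border a Gaussian integral, and the block the
same transform at the Schur complement of Z (`laplace_step`). Squaring turns half-integer powers
into integer ones, so induction on p shows that transform² · det Z^N is constant with no choice of
branch (`laplace_integrable_and_sq`). The remaining sign is fixed by continuity along the segment
from 1 to Z. -/

namespace MVarma

noncomputable section

/-! ### Bordered matrices and Schur complements. -/

open Matrix

/-- The matrix with corner entry `s`, first row and column `v`, and remaining block `W`. -/
def bordered {R : Type*} {p : ℕ} (s : R) (v : Fin p → R) (W : Matrix (Fin p) (Fin p) R) :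
    Matrix (Fin (p + 1)) (Fin (p + 1)) R :=
  Matrix.of fun i j =>
    Fin.cases (motive := fun _ => R) (Fin.cases (motive := fun _ => R) s v j)
      (fun i' => Fin.cases (motive := fun _ => R) (v i') (W i') j) i

section Bordered

variable {R : Type*} {p : ℕ} (s : R) (v : Fin p → R) (W : Matrix (Fin p) (Fin p) R)

@[simp] lemma bordered_zero_zero : bordered s v W 0 0 = s := rfl
@[simp] lemma bordered_zero_succ (j : Fin p) : bordered s v W 0 j.succ = v j := rfl
@[simp] lemma bordered_succ_zero (i : Fin p) : bordered s v W i.succ 0 = v i := rfl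
@[simp] lemma bordered_succ_succ (i j : Fin p) : bordered s v W i.succ j.succ = W i j := rfl

lemma eq_bordered {Z : Matrix (Fin (p + 1)) (Fin (p + 1)) R} (hZ : Z.IsSymm) :
    Z = bordered (Z 0 0) (fun j => Z 0 j.succ) (Z.submatrix Fin.succ Fin.succ) := by
  ext i j
  refine Fin.cases ?_ (fun i => ?_) i <;> refine Fin.cases ?_ (fun j => ?_) j
  · rfl
  · rfl
  · exact hZ.apply _ _
  · rfl

lemma bordered_map {S : Type*} (f : R → S) :
    (bordered s v W).map f = bordered (f s) (f ∘ v) (W.map f) := by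
  ext i j
  refine Fin.cases ?_ (fun i => ?_) i <;> refine Fin.cases ?_ (fun j => ?_) j <;> rfl

/-- Splitting off the first index. -/
def headEquiv (p : ℕ) : Unit ⊕ Fin p ≃ Fin (p + 1) where
  toFun := Sum.elim (fun _ => 0) Fin.succ
  invFun i := Fin.cases (motive := fun _ => Unit ⊕ Fin p) (Sum.inl ()) Sum.inr i
  left_inv := by rintro (_ | i) <;> rfl
  right_inv i := by refine Fin.cases ?_ (fun i => ?_) i <;> rfl

lemma bordered_submatrix : (bordered s v W).submatrix (headEquiv p) (headEquiv p) =
    fromBlocks (of fun _ _ => s) (of fun _ j => v j) (of fun i _ => v i) W := by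
  ext i j
  rcases i with i | i <;> rcases j with j | j <;> rfl

end Bordered

/-- Schur complement of the block, used for X, whose corner is integrated with the block fixed. The
complement of the corner, next, is used for Z. -/
lemma det_bordered_of_block {K : Type*} [Field K] {p : ℕ} (s : K) (v : Fin p → K)
    {W : Matrix (Fin p) (Fin p) K} (hW : IsUnit W.det) :
    (bordered s v W).det = W.det * (s - v ⬝ᵥ W⁻¹ *ᵥ v) := by
  have : Invertible W := W.invertibleOfIsUnitDet hW
  rw [← det_submatrix_equiv_self (headEquiv p), bordered_submatrix, det_fromBlocks₂₂,
    invOf_eq_nonsing_inv]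
  congr 1
  rw [det_unique, Matrix.sub_apply, of_apply, Matrix.mul_assoc]
  rfl

lemma det_bordered_of_corner {K : Type*} [Field K] {p : ℕ} {z : K} (hz : z ≠ 0) (v : Fin p → K)
    (W : Matrix (Fin p) (Fin p) K) :
    (bordered z v W).det = z * (W - z⁻¹ • vecMulVec v v).det := by
  have hdet : (of fun _ _ => z : Matrix Unit Unit K).det = z := by simp
  have : Invertible (of fun _ _ => z : Matrix Unit Unit K) :=
    Matrix.invertibleOfIsUnitDet _ (by rw [hdet]; exact hz.isUnit)
  have hinv : (of fun _ _ => z : Matrix Unit Unit K)⁻¹ = of fun _ _ => z⁻¹ := by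
    apply inv_eq_right_inv
    ext i j
    simp [Matrix.mul_apply, hz]
  rw [← det_submatrix_equiv_self (headEquiv p), bordered_submatrix, det_fromBlocks₁₁,
    invOf_eq_nonsing_inv, hinv, hdet]
  congr 3
  ext i j
  simp [Matrix.mul_apply, vecMulVec_apply]
  ring

lemma trace_bordered_mul_bordered {R : Type*} [CommRing R] {p : ℕ} (z s : R) (ζ v : Fin p → R)
    (Y W : Matrix (Fin p) (Fin p) R) :
    (bordered z ζ Y * bordered s v W).trace = z * s + 2 * (ζ ⬝ᵥ v) + (Y * W).trace := by
  simp only [Matrix.trace, Matrix.diag, Matrix.mul_apply, Fin.sum_univ_succ, bordered_zero_zero,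
    bordered_zero_succ, bordered_succ_zero, bordered_succ_succ, dotProduct,
    Finset.sum_add_distrib]
  ring

/-- The Schur criterion for semidefiniteness gives the weak inequality; nonvanishing of the
determinant makes it strict. -/
lemma posDef_bordered_iff {p : ℕ} (s : ℝ) (v : Fin p → ℝ) (W : Matrix (Fin p) (Fin p) ℝ) :
    (bordered s v W).PosDef ↔ W.PosDef ∧ v ⬝ᵥ W⁻¹ *ᵥ v < s := by
  have key : ∀ hW : W.PosDef, (bordered s v W).PosSemidef ↔ v ⬝ᵥ W⁻¹ *ᵥ v ≤ s := by
    intro hW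
    have : Invertible W := W.invertibleOfIsUnitDet hW.det_pos.ne'.isUnit
    rw [← posSemidef_submatrix_equiv (headEquiv p), bordered_submatrix]
    have h1 : (of fun i _ => v i : Matrix (Fin p) Unit ℝ) = (of fun _ j => v j)ᴴ := by
      ext; simp
    rw [h1, PosDef.fromBlocks₂₂ _ _ hW]
    have h2 : (of fun _ _ => s : Matrix Unit Unit ℝ) -
        (of fun _ j => v j) * W⁻¹ * (of fun _ j => v j)ᴴ =
          diagonal fun _ => s - v ⬝ᵥ W⁻¹ *ᵥ v := by
      ext i j
      rw [← h1, Matrix.mul_assoc]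
      simp [Matrix.mul_apply, dotProduct, mulVec]
    rw [h2, posSemidef_diagonal_iff]
    simp
  constructor
  · intro h
    have hW : W.PosDef := by
      have := h.submatrix (e := Fin.succ) (Fin.succ_injective _)
      exact this
    refine ⟨hW, lt_of_le_of_ne ((key hW).1 h.posSemidef) fun hs => ?_⟩
    have := h.det_pos
    rw [det_bordered_of_block s v hW.det_pos.ne'.isUnit, hs, sub_self, mul_zero] at this
    exact lt_irrefl _ this
  · rintro ⟨hW, hs⟩
    rw [((key hW).2 hs.le).posDef_iff_det_ne_zero,
      det_bordered_of_block s v hW.det_pos.ne'.isUnit]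
    exact mul_ne_zero hW.det_pos.ne' (sub_pos.2 hs).ne'

open scoped MatrixOrder in
/-- A positive definite real matrix is `B Bᵀ` with `B` invertible. -/
lemma exists_eq_mul_transpose {p : ℕ} {W : Matrix (Fin p) (Fin p) ℝ} (hW : W.PosDef) :
    ∃ B : Matrix (Fin p) (Fin p) ℝ, W = B * Bᵀ ∧ B.det ≠ 0 := by
  obtain ⟨C, hC⟩ := CStarAlgebra.nonneg_iff_eq_star_mul_self.mp
    (Matrix.nonneg_iff_posSemidef.mpr hW.posSemidef)
  refine ⟨Cᵀ, ?_, fun h => ?_⟩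
  · rw [hC]; rfl
  · have := hW.det_pos
    rw [hC, det_mul] at this
    rw [det_transpose] at h
    rw [h, mul_zero] at this
    exact lt_irrefl _ this

/-! ### Symmetric matrices with positive definite real part. -/

/-- Complex symmetric matrices with positive definite real part. -/
structure Accretive {p : ℕ} (Z : Matrix (Fin p) (Fin p) ℂ) : Prop where
  symm : Z.IsSymm
  re_posDef : (Z.map Complex.re).PosDef

/-- The imaginary part of Z enters only through cross terms, which cancel by symmetry. -/
lemma re_star_dotProduct_mulVec {p : ℕ} {Z : Matrix (Fin p) (Fin p) ℂ} (hZ : Z.IsSymm)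
    (w : Fin p → ℂ) :
    (star w ⬝ᵥ Z *ᵥ w).re =
      (fun i => (w i).re) ⬝ᵥ Z.map Complex.re *ᵥ (fun i => (w i).re) +
      (fun i => (w i).im) ⬝ᵥ Z.map Complex.re *ᵥ (fun i => (w i).im) := by
  have hz : ∀ i j, Z j i = Z i j := fun i j => hZ.apply i j
  have hswap : ∑ i, ∑ j, (w i).re * ((Z i j).im * (w j).im) =
      ∑ i, ∑ j, (w i).im * ((Z i j).im * (w j).re) := by
    rw [Finset.sum_comm]
    refine Finset.sum_congr rfl fun i _ => Finset.sum_congr rfl fun j _ => ?_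
    rw [hz i j]; ring
  simp only [dotProduct, mulVec, Finset.mul_sum, Complex.re_sum, Pi.star_apply, map_apply,
    RCLike.star_def, Complex.mul_re, Complex.mul_im, Complex.conj_re, Complex.conj_im]
  rw [← sub_eq_zero] at hswap
  rw [← sub_eq_zero, ← neg_eq_zero, ← hswap]
  simp only [← Finset.sum_sub_distrib, ← Finset.sum_add_distrib, ← Finset.sum_neg_distrib]
  refine Finset.sum_congr rfl fun i _ => Finset.sum_congr rfl fun j _ => ?_
  ring

lemma Accretive.re_pos {p : ℕ} {Z : Matrix (Fin p) (Fin p) ℂ} (hZ : Accretive Z)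
    {w : Fin p → ℂ} (hw : w ≠ 0) : 0 < (star w ⬝ᵥ Z *ᵥ w).re := by
  rw [re_star_dotProduct_mulVec hZ.symm]
  have h1 := hZ.re_posDef.posSemidef.dotProduct_mulVec_nonneg (fun i => (w i).re)
  have h2 := hZ.re_posDef.posSemidef.dotProduct_mulVec_nonneg (fun i => (w i).im)
  rw [star_trivial] at h1 h2
  by_cases hre : (fun i => (w i).re) = 0
  · have him : (fun i => (w i).im) ≠ 0 := by
      intro him
      exact hw (funext fun i => Complex.ext (congrFun hre i) (congrFun him i))
    have := hZ.re_posDef.dotProduct_mulVec_pos him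
    rw [star_trivial] at this
    linarith
  · have := hZ.re_posDef.dotProduct_mulVec_pos hre
    rw [star_trivial] at this
    linarith

lemma Accretive.corner {p : ℕ} {z : ℂ} {ζ : Fin p → ℂ} {Y : Matrix (Fin p) (Fin p) ℂ}
    (h : Accretive (bordered z ζ Y)) : 0 < z.re := by
  have := h.re_posDef.diag_pos (i := 0)
  simpa using this

/-- Extend a real vector y by the first coordinate that makes the first entry of Zw vanish. The form
of Z at w is then the form of the Schur complement at y. -/
lemma Accretive.schur {p : ℕ} {z : ℂ} {ζ : Fin p → ℂ} {Y : Matrix (Fin p) (Fin p) ℂ}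
    (h : Accretive (bordered z ζ Y)) : Accretive (Y - z⁻¹ • vecMulVec ζ ζ) := by
  have hz : z ≠ 0 := by
    rintro rfl
    exact lt_irrefl _ h.corner
  have hsymm : (Y - z⁻¹ • vecMulVec ζ ζ).IsSymm := by
    refine IsSymm.ext fun i j => ?_
    have := h.symm.apply i.succ j.succ
    simp only [bordered_succ_succ] at this
    simp [vecMulVec_apply, this, mul_comm]
  refine ⟨hsymm, PosDef.of_dotProduct_mulVec_pos ?_ fun y hy => ?_⟩
  · ext i j
    simp [conjTranspose_apply, ← hsymm.apply i j]
  · let yc : Fin p → ℂ := fun i => y i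
    have key := h.re_pos (w := Fin.cons (-(z⁻¹ * (ζ ⬝ᵥ yc))) yc) (by
      intro h0
      apply hy
      funext i
      have := congrFun h0 i.succ
      simpa [yc] using this)
    have e : star (Fin.cons (-(z⁻¹ * (ζ ⬝ᵥ yc))) yc : Fin (p + 1) → ℂ) ⬝ᵥ
        bordered z ζ Y *ᵥ (Fin.cons (-(z⁻¹ * (ζ ⬝ᵥ yc))) yc) =
        star yc ⬝ᵥ (Y - z⁻¹ • vecMulVec ζ ζ) *ᵥ yc := by
      have h0 : (bordered z ζ Y *ᵥ (Fin.cons (-(z⁻¹ * (ζ ⬝ᵥ yc))) yc)) 0 = 0 := by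
        simp only [mulVec, dotProduct, Fin.sum_univ_succ, bordered_zero_zero, bordered_zero_succ,
          Fin.cons_zero, Fin.cons_succ]
        field_simp
        ring
      have hs : ∀ i : Fin p, (bordered z ζ Y *ᵥ (Fin.cons (-(z⁻¹ * (ζ ⬝ᵥ yc))) yc)) i.succ =
          ((Y - z⁻¹ • vecMulVec ζ ζ) *ᵥ yc) i := by
        intro i
        simp only [mulVec, dotProduct, Fin.sum_univ_succ, bordered_succ_zero, bordered_succ_succ,
          Fin.cons_zero, Fin.cons_succ, Matrix.sub_apply, Matrix.smul_apply, vecMulVec_apply, sub_mul,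
          Finset.sum_sub_distrib, smul_eq_mul, Finset.mul_sum, mul_neg]
        rw [neg_add_eq_sub]
        congr 1
        exact Finset.sum_congr rfl fun j _ => by ring
      rw [dotProduct, Fin.sum_univ_succ, h0, mul_zero, zero_add]
      exact Finset.sum_congr rfl fun i _ => by rw [hs]; rfl
    rw [e, re_star_dotProduct_mulVec hsymm] at key
    have him : (fun i => (yc i).im) = 0 := by funext i; simp [yc]
    have hre : (fun i => (yc i).re) = y := by funext i; simp [yc]
    rw [him, hre] at key
    simpa using key

lemma Accretive.toComplex_re {p : ℕ} {Z : Matrix (Fin p) (Fin p) ℂ} (hZ : Accretive Z) :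
    Accretive (toComplex (Z.map Complex.re)) := by
  refine ⟨IsSymm.ext fun i j => ?_, ?_⟩
  · simp [toComplex, hZ.symm.apply i j]
  · have : (toComplex (Z.map Complex.re)).map Complex.re = Z.map Complex.re := by
      ext; simp [toComplex]
    rw [this]
    exact hZ.re_posDef

/-! ### The gamma integral with complex rate. -/

section GammaIntegral

open Set

lemma integrableOn_rpow_mul_exp_neg {c r : ℝ} (hc : 0 < c) (hr : 0 < r) :
    IntegrableOn (fun t : ℝ => t ^ (c - 1) * Real.exp (-(r * t))) (Ioi 0) := by
  have := integrableOn_rpow_mul_exp_neg_mul_rpow (p := 1) (s := c - 1) (b := r) (by linarith)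
    one_pos hr
  simpa using this

lemma norm_ofReal_rpow_mul_cexp {c : ℝ} (z : ℂ) {t : ℝ} (ht : 0 ≤ t) :
    ‖((t ^ (c - 1) : ℝ) : ℂ) * Complex.exp (-(z * t))‖ =
      t ^ (c - 1) * Real.exp (-(z.re * t)) := by
  rw [norm_mul, Complex.norm_exp, Complex.norm_real, Real.norm_of_nonneg (Real.rpow_nonneg ht _)]
  simp

lemma aestronglyMeasurable_rpow_mul_cexp (c : ℝ) (z : ℂ) (μ : Measure ℝ) :
    AEStronglyMeasurable (fun t : ℝ => ((t ^ (c - 1) : ℝ) : ℂ) * Complex.exp (-(z * t))) μ := by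
  apply Measurable.aestronglyMeasurable
  fun_prop

lemma integrableOn_rpow_mul_cexp_neg {c : ℝ} (hc : 0 < c) {z : ℂ} (hz : 0 < z.re) :
    IntegrableOn (fun t : ℝ => ((t ^ (c - 1) : ℝ) : ℂ) * Complex.exp (-(z * t))) (Ioi 0) := by
  refine (integrableOn_rpow_mul_exp_neg hc hz).mono' (aestronglyMeasurable_rpow_mul_cexp _ _ _) ?_
  filter_upwards [ae_restrict_mem measurableSet_Ioi] with t ht
  exact (norm_ofReal_rpow_mul_cexp z (le_of_lt ht)).le

/-- Both sides are holomorphic in z on the right half-plane and agree at positive reals accumulating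
at 1. -/
lemma integral_rpow_mul_cexp_neg {c : ℝ} (hc : 0 < c) {z : ℂ} (hz : 0 < z.re) :
    ∫ t in Ioi (0 : ℝ), ((t ^ (c - 1) : ℝ) : ℂ) * Complex.exp (-(z * t)) =
      Complex.Gamma c * z ^ (-(c : ℂ)) := by
  let U : Set ℂ := {w | 0 < w.re}
  have hU : IsOpen U := isOpen_lt continuous_const Complex.continuous_re
  have hf : DifferentiableOn ℂ (fun w : ℂ => ∫ t in Ioi (0 : ℝ),
      ((t ^ (c - 1) : ℝ) : ℂ) * Complex.exp (-(w * t))) U := by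
    intro w hw
    have hw : 0 < w.re := hw
    have hs : {x : ℂ | w.re / 2 < x.re} ∈ nhds w :=
      (isOpen_lt continuous_const Complex.continuous_re).mem_nhds
        (show w.re / 2 < w.re by linarith)
    have := hasDerivAt_integral_of_dominated_loc_of_deriv_le (𝕜 := ℂ)
      (μ := volume.restrict (Ioi (0 : ℝ)))
      (F := fun (w : ℂ) (t : ℝ) => ((t ^ (c - 1) : ℝ) : ℂ) * Complex.exp (-(w * t)))
      (F' := fun (w : ℂ) (t : ℝ) => ((t ^ (c - 1) : ℝ) : ℂ) * (Complex.exp (-(w * t)) * (-t)))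
      -- Near w the real part exceeds Re w / 2, and differentiation in w costs one factor t.
      (bound := fun t => t ^ (c + 1 - 1) * Real.exp (-(w.re / 2 * t))) hs
      (Filter.Eventually.of_forall fun w => aestronglyMeasurable_rpow_mul_cexp _ _ _)
      (integrableOn_rpow_mul_cexp_neg hc hw)
      (by apply Measurable.aestronglyMeasurable; fun_prop)
      (by
        filter_upwards [ae_restrict_mem measurableSet_Ioi] with t ht x hx
        have ht : 0 < t := ht
        have hx : w.re / 2 < x.re := hx
        rw [← mul_assoc, norm_mul, norm_ofReal_rpow_mul_cexp x ht.le, norm_neg,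
          Complex.norm_real, Real.norm_of_nonneg ht.le, mul_right_comm, ← Real.rpow_add_one ht.ne']
        rw [show c - 1 + 1 = c + 1 - 1 by ring]
        gcongr)
      (integrableOn_rpow_mul_exp_neg (by linarith) (by linarith))
      (by
        refine Filter.Eventually.of_forall fun t x _ => ?_
        refine HasDerivAt.const_mul _ (HasDerivAt.cexp ?_)
        have h := ((hasDerivAt_id x).mul_const (t : ℂ)).fun_neg
        rw [one_mul] at h
        exact h)
    exact this.2.differentiableAt.differentiableWithinAt
  have hg : DifferentiableOn ℂ (fun w : ℂ => Complex.Gamma c * w ^ (-(c : ℂ))) U := by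
    intro w hw
    refine DifferentiableAt.differentiableWithinAt ?_
    exact (differentiableAt_id.cpow_const (Or.inl hw)).const_mul _
  have hconv : IsPreconnected U := (convex_halfSpace_re_gt 0).isPreconnected
  refine (hf.analyticOnNhd hU).eqOn_of_preconnected_of_frequently_eq (hg.analyticOnNhd hU) hconv
    (z₀ := 1) (by simp [U]) ?_ hz
  have hreal : ∀ r : ℝ, 0 < r → (∫ t in Ioi (0 : ℝ),
      ((t ^ (c - 1) : ℝ) : ℂ) * Complex.exp (-((r : ℂ) * t))) =
      Complex.Gamma c * (r : ℂ) ^ (-(c : ℂ)) := by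
    intro r hr
    have e := Real.integral_rpow_mul_exp_neg_mul_Ioi hc hr
    rw [Complex.Gamma_ofReal, ← Complex.ofReal_neg, ← Complex.ofReal_cpow hr.le,
      ← Complex.ofReal_mul, Real.rpow_neg hr.le, ← Real.inv_rpow hr.le, ← one_div,
      mul_comm (Real.Gamma c), ← e, ← integral_complex_ofReal]
    simp
  have htend : Filter.Tendsto (fun n : ℕ => ((1 + 1 / ((n : ℝ) + 1) : ℝ) : ℂ)) Filter.atTop
      (nhdsWithin 1 {1}ᶜ) := by
    refine tendsto_nhdsWithin_iff.2 ⟨?_, Filter.Eventually.of_forall fun n => ?_⟩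
    · have := (tendsto_one_div_add_atTop_nhds_zero_nat (𝕜 := ℝ)).const_add 1
      have h := (Complex.continuous_ofReal.tendsto _).comp this
      rw [add_zero, Complex.ofReal_one] at h
      exact h
    · have : (0 : ℝ) < 1 / ((n : ℝ) + 1) := by positivity
      simp only [mem_compl_iff, mem_singleton_iff]
      rw [← Complex.ofReal_one, Complex.ofReal_inj]
      linarith
  refine htend.frequently (Filter.Frequently.of_forall fun n => ?_)
  exact hreal _ (by positivity)

lemma integrable_indicator_shifted_gamma {c : ℝ} (hc : 0 < c) {z : ℂ} (hz : 0 < z.re) (σ : ℝ) :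
    Integrable (indicator (Ioi σ) fun x : ℝ =>
      (((x - σ) ^ (c - 1) : ℝ) : ℂ) * Complex.exp (-(z * x))) := by
  have h := ((integrable_indicator_iff measurableSet_Ioi).2
    (integrableOn_rpow_mul_cexp_neg hc hz)).comp_sub_right σ
  refine (h.const_mul (Complex.exp (-(z * σ)))).congr (Filter.Eventually.of_forall fun x => ?_)
  by_cases hx : σ < x
  · simp only [indicator, mem_Ioi, sub_pos, hx, if_true]
    rw [mul_left_comm, ← Complex.exp_add]
    congr 2
    push_cast; ring
  · simp [indicator, hx]

lemma integral_indicator_shifted_gamma {c : ℝ} (hc : 0 < c) {z : ℂ} (hz : 0 < z.re) (σ : ℝ) :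
    ∫ x : ℝ, indicator (Ioi σ) (fun x : ℝ =>
      (((x - σ) ^ (c - 1) : ℝ) : ℂ) * Complex.exp (-(z * x))) x =
      Complex.Gamma c * z ^ (-(c : ℂ)) * Complex.exp (-(z * σ)) := by
  rw [← integral_rpow_mul_cexp_neg hc hz, ← integral_indicator measurableSet_Ioi,
    ← integral_sub_right_eq_self (indicator (Ioi (0 : ℝ)) _) σ, ← integral_mul_const]
  refine integral_congr_ae (Filter.Eventually.of_forall fun x => ?_)
  by_cases hx : σ < x
  · simp only [indicator, mem_Ioi, sub_pos, hx, if_true]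
    rw [mul_assoc, ← Complex.exp_add]
    congr 2
    push_cast; ring
  · simp [indicator, hx]

end GammaIntegral

/-! ### Gaussian integrals with a complex parameter. -/

section Gaussian

variable {p : ℕ}

lemma toComplex_mul (A B : Matrix (Fin p) (Fin p) ℝ) :
    toComplex (A * B) = toComplex A * toComplex B :=
  Matrix.map_mul (f := Complex.ofRealHom)

/-- With W = B Bᵀ, the substitution v = By turns the quadratic form into a sum of squares. The
Jacobian |det B| is the factor (det W)^(1/2) of the Gaussian integral. -/
lemma gaussian_exponent_comp (z : ℂ) (ζ : Fin p → ℂ) {B : Matrix (Fin p) (Fin p) ℝ}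
    (hB : B.det ≠ 0) (y : Fin p → ℝ) :
    -(z * ((B *ᵥ y ⬝ᵥ (B * Bᵀ)⁻¹ *ᵥ (B *ᵥ y) : ℝ) : ℂ)) -
        2 * (ζ ⬝ᵥ fun i => ((B *ᵥ y) i : ℂ)) =
      -z * ∑ i, (y i : ℂ) ^ 2 + ∑ i, (-2 * (ζ ᵥ* toComplex B) i) * y i := by
  have h1 : B *ᵥ y ⬝ᵥ (B * Bᵀ)⁻¹ *ᵥ (B *ᵥ y) = ∑ i, y i ^ 2 := by
    have hu : IsUnit B.det := hB.isUnit
    have hut : IsUnit Bᵀ.det := by rwa [det_transpose]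
    rw [Matrix.mul_inv_rev, mulVec_mulVec, Matrix.mul_assoc, Matrix.nonsing_inv_mul _ hu,
      Matrix.mul_one, dotProduct_mulVec, ← mulVec_transpose, mulVec_mulVec,
      transpose_nonsing_inv, transpose_transpose, Matrix.nonsing_inv_mul _ hu, one_mulVec]
    simp [dotProduct, sq]
  have h2 : (ζ ⬝ᵥ fun i => ((B *ᵥ y) i : ℂ)) = ∑ i, (ζ ᵥ* toComplex B) i * y i := by
    have : (fun i => ((B *ᵥ y) i : ℂ)) = toComplex B *ᵥ (fun i => (y i : ℂ)) := by
      funext i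
      simp [toComplex, mulVec, dotProduct]
    rw [this, dotProduct_mulVec]
    rfl
  rw [h1, h2, Complex.ofReal_sum, Finset.mul_sum, Finset.mul_sum, Finset.mul_sum,
    ← Finset.sum_neg_distrib, ← Finset.sum_sub_distrib, ← Finset.sum_add_distrib]
  refine Finset.sum_congr rfl fun i _ => ?_
  push_cast
  ring

lemma measurableEmbedding_mulVec {B : Matrix (Fin p) (Fin p) ℝ} (hB : B.det ≠ 0) :
    MeasurableEmbedding (fun y : Fin p → ℝ => B *ᵥ y) := by
  have := (LinearMap.equivOfDetNeZero (toLin' B)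
    (by rwa [LinearMap.det_toLin'])).toContinuousLinearEquiv.toHomeomorph.measurableEmbedding
  exact this

lemma map_mulVec_volume {B : Matrix (Fin p) (Fin p) ℝ} (hB : B.det ≠ 0) :
    Measure.map (fun y : Fin p → ℝ => B *ᵥ y) volume =
      ENNReal.ofReal |B.det|⁻¹ • (volume : Measure (Fin p → ℝ)) := by
  have := Real.map_matrix_volume_pi_eq_smul_volume_pi hB
  rw [abs_inv] at this
  exact this

/-- The integrand of the Gaussian integral with covariance `W`. -/
def gaussianIntegrand (z : ℂ) (ζ : Fin p → ℂ) (W : Matrix (Fin p) (Fin p) ℝ) (v : Fin p → ℝ) : ℂ :=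
  Complex.exp (-(z * ((v ⬝ᵥ W⁻¹ *ᵥ v : ℝ) : ℂ)) - 2 * (ζ ⬝ᵥ fun i => (v i : ℂ)))

lemma integrable_gaussianIntegrand {z : ℂ} (hz : 0 < z.re) (ζ : Fin p → ℂ)
    {W : Matrix (Fin p) (Fin p) ℝ} (hW : W.PosDef) : Integrable (gaussianIntegrand z ζ W) := by
  obtain ⟨B, rfl, hB⟩ := exists_eq_mul_transpose hW
  have h0 : ENNReal.ofReal |B.det|⁻¹ ≠ 0 := by
    simpa using hB
  rw [← integrable_smul_measure h0 ENNReal.ofReal_ne_top, ← map_mulVec_volume hB,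
    (measurableEmbedding_mulVec hB).integrable_map_iff]
  refine (GaussianFourier.integrable_cexp_neg_mul_sum_add hz
    fun i => -2 * (ζ ᵥ* toComplex B) i).congr (Filter.Eventually.of_forall fun y => ?_)
  simp only [Function.comp, gaussianIntegrand]
  rw [gaussian_exponent_comp z ζ hB]

lemma integral_gaussianIntegrand {z : ℂ} (hz : 0 < z.re) (ζ : Fin p → ℂ)
    {W : Matrix (Fin p) (Fin p) ℝ} (hW : W.PosDef) :
    ∫ v, gaussianIntegrand z ζ W v =
      ((W.det ^ (1 / 2 : ℝ) : ℝ) : ℂ) * ((Real.pi / z) ^ (p / 2 : ℂ) *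
        Complex.exp ((vecMulVec ζ ζ * toComplex W).trace / z)) := by
  obtain ⟨B, rfl, hB⟩ := exists_eq_mul_transpose hW
  have hz0 : z ≠ 0 := by rintro rfl; exact lt_irrefl _ hz
  have hdet : (B * Bᵀ).det ^ (1 / 2 : ℝ) = |B.det| := by
    rw [det_mul, det_transpose, ← Real.sqrt_eq_rpow, Real.sqrt_mul_self_eq_abs]
  have h1 : ∫ v, gaussianIntegrand z ζ (B * Bᵀ) v =
      |B.det| • ∫ v, gaussianIntegrand z ζ (B * Bᵀ) v ∂(ENNReal.ofReal |B.det|⁻¹ • volume) := by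
    rw [integral_smul_measure, ENNReal.toReal_ofReal (by positivity), smul_smul,
      mul_inv_cancel₀ (abs_ne_zero.2 hB), one_smul]
  rw [h1, ← map_mulVec_volume hB, (measurableEmbedding_mulVec hB).integral_map, hdet,
    Complex.real_smul]
  congr 1
  have h2 := GaussianFourier.integral_cexp_neg_mul_sum_add hz
    fun i => -2 * (ζ ᵥ* toComplex B) i
  simp only [Fintype.card_fin] at h2
  have h3 : ∑ i, (-2 * (ζ ᵥ* toComplex B) i) ^ 2 =
      4 * (vecMulVec ζ ζ * toComplex (B * Bᵀ)).trace := by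
    have : (vecMulVec ζ ζ * toComplex (B * Bᵀ)).trace =
        (ζ ᵥ* toComplex B) ⬝ᵥ (ζ ᵥ* toComplex B) := by
      rw [vecMulVec_mul, trace_vecMulVec, toComplex_mul, ← vecMul_vecMul, dotProduct_comm]
      have ht : toComplex Bᵀ = (toComplex B)ᵀ := rfl
      rw [ht, vecMul_transpose, dotProduct_comm, dotProduct_mulVec]
    rw [this, dotProduct, Finset.mul_sum]
    exact Finset.sum_congr rfl fun i _ => by ring
  rw [h3, mul_div_mul_left _ _ (by norm_num : (4 : ℂ) ≠ 0)] at h2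
  rw [← h2]
  refine integral_congr_ae (Filter.Eventually.of_forall fun y => ?_)
  simp only [gaussianIntegrand]
  rw [gaussian_exponent_comp z ζ hB]

end Gaussian

/-! ### Coordinates on symmetric matrices. -/

section Coordinates

variable {p : ℕ}

lemma continuous_symMatrix : Continuous (symMatrix : (UpperIndex p → ℝ) → _) :=
  continuous_matrix fun _ _ => continuous_apply _

lemma continuous_toComplex :
    Continuous (toComplex : Matrix (Fin p) (Fin p) ℝ → Matrix (Fin p) (Fin p) ℂ) :=
  continuous_id.matrix_map Complex.continuous_ofReal

lemma isHermitian_symMatrix (x : UpperIndex p → ℝ) : (symMatrix x).IsHermitian := by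
  ext i j
  simp [symMatrix, min_comm, max_comm]

/-- Positive definite means semidefinite, a closed condition, together with nonzero determinant, an
open one. -/
lemma measurableSet_posDefCone : MeasurableSet (posDefCone p) := by
  have h : posDefCone p = (⋂ v : Fin p → ℝ, {x | 0 ≤ v ⬝ᵥ symMatrix x *ᵥ v}) ∩
      {x | (symMatrix x).det ≠ 0} := by
    ext x
    simp only [posDefCone, Set.mem_ofPred_eq, Set.mem_inter_iff, Set.mem_iInter]
    constructor
    · intro hx
      exact ⟨fun v => by simpa using hx.posSemidef.dotProduct_mulVec_nonneg v, hx.det_pos.ne'⟩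
    · rintro ⟨h1, h2⟩
      have : (symMatrix x).PosSemidef :=
        .of_dotProduct_mulVec_nonneg (isHermitian_symMatrix x) (by simpa using h1)
      exact this.posDef_iff_det_ne_zero.2 h2
  rw [h]
  refine MeasurableSet.inter (IsClosed.measurableSet ?_) (IsOpen.measurableSet ?_)
  · refine isClosed_iInter fun v => isClosed_le continuous_const ?_
    exact continuous_const.dotProduct (continuous_symMatrix.matrix_mulVec continuous_const)
  · exact isOpen_ne_fun continuous_symMatrix.matrix_det continuous_const

/-- The indices of the independent entries of a bordered symmetric matrix. -/
def borderIndexMap (p : ℕ) : UpperIndex p ⊕ (Fin p ⊕ Unit) → UpperIndex (p + 1) :=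
  Sum.elim (fun ij => ⟨(ij.1.1.succ, ij.1.2.succ), Fin.succ_le_succ_iff.2 ij.2⟩)
    (Sum.elim (fun j => ⟨(0, j.succ), Fin.zero_le _⟩) (fun _ => ⟨(0, 0), le_rfl⟩))

lemma borderIndexMap_bijective (p : ℕ) : Function.Bijective (borderIndexMap p) := by
  constructor
  · rintro (⟨⟨i, j⟩, h⟩ | j | ⟨⟩) (⟨⟨i', j'⟩, h'⟩ | j' | ⟨⟩) <;>
      simp [borderIndexMap, Fin.succ_ne_zero, (Fin.succ_ne_zero _).symm]
  · rintro ⟨⟨i, j⟩, h⟩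
    revert h
    refine Fin.cases ?_ (fun i => ?_) i <;> refine Fin.cases ?_ (fun j => ?_) j <;> intro h
    · exact ⟨Sum.inr (Sum.inr ()), rfl⟩
    · exact ⟨Sum.inr (Sum.inl j), rfl⟩
    · exact absurd h (by simp)
    · exact ⟨Sum.inl ⟨(i, j), Fin.succ_le_succ_iff.1 h⟩, rfl⟩

/-- `borderIndexMap` as an equivalence. -/
def borderIndexEquiv (p : ℕ) : UpperIndex p ⊕ (Fin p ⊕ Unit) ≃ UpperIndex (p + 1) :=
  Equiv.ofBijective _ (borderIndexMap_bijective p)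

/-- The independent entries of a bordered symmetric matrix, from those of its block, its border
and its corner. -/
def borderEquiv (p : ℕ) :
    (UpperIndex p → ℝ) × ((Fin p → ℝ) × ℝ) ≃ᵐ (UpperIndex (p + 1) → ℝ) :=
  ((MeasurableEquiv.refl _).prodCongr
    (((MeasurableEquiv.refl _).prodCongr (MeasurableEquiv.funUnique Unit ℝ).symm).trans
      (MeasurableEquiv.sumPiEquivProdPi (fun _ : Fin p ⊕ Unit => ℝ)).symm)).trans
    ((MeasurableEquiv.sumPiEquivProdPi (fun _ : UpperIndex p ⊕ (Fin p ⊕ Unit) => ℝ)).symm.trans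
      (MeasurableEquiv.piCongrLeft (fun _ : UpperIndex (p + 1) => ℝ) (borderIndexEquiv p)))

lemma measurePreserving_borderEquiv (p : ℕ) : MeasurePreserving (borderEquiv p) := by
  refine MeasurePreserving.trans (MeasurePreserving.prod (MeasurePreserving.id _)
    (MeasurePreserving.trans (MeasurePreserving.prod (MeasurePreserving.id _)
      (volume_preserving_funUnique Unit ℝ).symm)
        (volume_measurePreserving_sumPiEquivProdPi_symm _)))
    (MeasurePreserving.trans (volume_measurePreserving_sumPiEquivProdPi_symm _)
      (volume_measurePreserving_piCongrLeft _ _))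

lemma borderEquiv_apply (w : UpperIndex p → ℝ) (v : Fin p → ℝ) (s : ℝ)
    (a : UpperIndex p ⊕ (Fin p ⊕ Unit)) :
    borderEquiv p (w, v, s) (borderIndexMap p a) =
      Sum.elim w (Sum.elim v fun _ => s) a := by
  have : borderEquiv p (w, v, s) (borderIndexEquiv p a) = Sum.elim w (Sum.elim v fun _ => s) a := by
    simp only [borderEquiv, MeasurableEquiv.trans_apply]
    rw [MeasurableEquiv.piCongrLeft_apply_apply]
    rcases a with a | a | a <;> rfl
  exact this

lemma symMatrix_borderEquiv (w : UpperIndex p → ℝ) (v : Fin p → ℝ) (s : ℝ) :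
    symMatrix (borderEquiv p (w, v, s)) = bordered s v (symMatrix w) := by
  ext i j
  refine Fin.cases ?_ (fun i => ?_) i <;> refine Fin.cases ?_ (fun j => ?_) j
  · exact borderEquiv_apply w v s (Sum.inr (Sum.inr ()))
  · rw [bordered_zero_succ, ← show _ = v j from borderEquiv_apply w v s (Sum.inr (Sum.inl j))]
    simp [symMatrix, borderIndexMap]
  · rw [bordered_succ_zero, ← show _ = v i from borderEquiv_apply w v s (Sum.inr (Sum.inl i))]
    simp [symMatrix, borderIndexMap]
  · rw [bordered_succ_succ, ← show _ = symMatrix w i j from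
      borderEquiv_apply w v s (Sum.inl ⟨(min i j, max i j), min_le_max⟩)]
    simp only [symMatrix, borderIndexMap, of_apply, Sum.elim_inl]
    have h1 : min i.succ j.succ = (min i j).succ :=
      ((Fin.strictMono_succ.monotone).map_min).symm
    have h2 : max i.succ j.succ = (max i j).succ :=
      ((Fin.strictMono_succ.monotone).map_max).symm
    simp only [h1, h2]

lemma card_upperIndex (p : ℕ) : Fintype.card (UpperIndex p) * 2 = p * (p + 1) := by
  induction p with
  | zero => simp
  | succ p ih =>
    rw [← Fintype.card_congr (borderIndexEquiv p), Fintype.card_sum, Fintype.card_sum,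
      Fintype.card_fin, Fintype.card_unit, add_mul, ih]
    ring

end Coordinates

/-! ### Laplace transform of a determinant power: one inductive step. -/

section Laplace

variable {p : ℕ}

/-- The integrand `|X|^{N/2 - (p+1)/2} etr(-ZX)` of the Laplace transform of a power of the
determinant. -/
def laplaceIntegrand (N : ℕ) (Z : Matrix (Fin p) (Fin p) ℂ) (X : Matrix (Fin p) (Fin p) ℝ) : ℂ :=
  ((X.det ^ ((N : ℝ) / 2 - ((p : ℝ) + 1) / 2) : ℝ) : ℂ) *
    Complex.exp (-(Z * toComplex X).trace)

lemma measurable_laplaceIntegrand (N : ℕ) (Z : Matrix (Fin p) (Fin p) ℂ) :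
    Measurable fun x : UpperIndex p → ℝ => laplaceIntegrand N Z (symMatrix x) := by
  have h1 : Measurable fun x : UpperIndex p → ℝ => (symMatrix x).det :=
    continuous_symMatrix.matrix_det.measurable
  have h2 : Measurable fun x : UpperIndex p → ℝ => (Z * toComplex (symMatrix x)).trace :=
    ((continuous_const.matrix_mul
      (continuous_toComplex.comp continuous_symMatrix)).matrix_trace).measurable
  unfold laplaceIntegrand
  fun_prop

lemma trace_re (Z : Matrix (Fin p) (Fin p) ℂ) (X : Matrix (Fin p) (Fin p) ℝ) :
    (Z * toComplex X).trace.re = (Z.map Complex.re * X).trace := by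
  simp [Matrix.trace, Matrix.mul_apply, toComplex]

lemma trace_toComplex_mul (U X : Matrix (Fin p) (Fin p) ℝ) :
    (toComplex U * toComplex X).trace = ((U * X).trace : ℝ) := by
  simp [Matrix.trace, Matrix.mul_apply, toComplex]

/-- The norm is again an integrand of the same kind, at Re Z. Iterated integrals of norms, needed
for Fubini, can therefore be evaluated by the same exact formulas. -/
lemma ofReal_norm_laplaceIntegrand (N : ℕ) (Z : Matrix (Fin p) (Fin p) ℂ)
    {X : Matrix (Fin p) (Fin p) ℝ} (hX : X.PosDef) :
    (‖laplaceIntegrand N Z X‖ : ℂ) = laplaceIntegrand N (toComplex (Z.map Complex.re)) X := by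
  rw [laplaceIntegrand, laplaceIntegrand, norm_mul, Complex.norm_exp, Complex.norm_real,
    Real.norm_of_nonneg (Real.rpow_nonneg hX.det_pos.le _), Complex.neg_re, trace_re,
    trace_toComplex_mul]
  push_cast
  rfl

/-- The factor of the Laplace integrand of a bordered matrix that depends on the border and the
corner. -/
def borderIntegrand (c : ℝ) (z : ℂ) (ζ : Fin p → ℂ) (W : Matrix (Fin p) (Fin p) ℝ)
    (y : (Fin p → ℝ) × ℝ) : ℂ :=
  Complex.exp (-(2 * (ζ ⬝ᵥ fun i => (y.1 i : ℂ)))) *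
    Set.indicator (Set.Ioi (y.1 ⬝ᵥ W⁻¹ *ᵥ y.1)) (fun x : ℝ =>
      (((x - y.1 ⬝ᵥ W⁻¹ *ᵥ y.1) ^ (c - 1) : ℝ) : ℂ) * Complex.exp (-(z * x))) y.2

lemma measurable_borderIntegrand (c : ℝ) (z : ℂ) (ζ : Fin p → ℂ)
    (W : Matrix (Fin p) (Fin p) ℝ) : Measurable (borderIntegrand c z ζ W) := by
  have h1 : Measurable fun y : (Fin p → ℝ) × ℝ => y.1 ⬝ᵥ W⁻¹ *ᵥ y.1 :=
    (continuous_fst.dotProduct (continuous_const.matrix_mulVec continuous_fst)).measurable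
  have h2 : Measurable fun y : (Fin p → ℝ) × ℝ => ζ ⬝ᵥ fun i => (y.1 i : ℂ) := by
    refine (continuous_const.dotProduct (continuous_pi fun i => ?_)).measurable
    fun_prop
  have h3 : Measurable fun y : (Fin p → ℝ) × ℝ =>
      Set.indicator {y : (Fin p → ℝ) × ℝ | y.1 ⬝ᵥ W⁻¹ *ᵥ y.1 < y.2} (fun y =>
        (((y.2 - y.1 ⬝ᵥ W⁻¹ *ᵥ y.1) ^ (c - 1) : ℝ) : ℂ) * Complex.exp (-(z * y.2))) y := by
    refine Measurable.indicator ?_ (measurableSet_lt h1 measurable_snd)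
    fun_prop
  exact (by fun_prop : Measurable fun y : (Fin p → ℝ) × ℝ =>
    Complex.exp (-(2 * (ζ ⬝ᵥ fun i => (y.1 i : ℂ))))).mul h3

lemma ofReal_norm_borderIntegrand (c : ℝ) (z : ℂ) (ζ : Fin p → ℂ)
    (W : Matrix (Fin p) (Fin p) ℝ) (y : (Fin p → ℝ) × ℝ) :
    (‖borderIntegrand c z ζ W y‖ : ℂ) =
      borderIntegrand c (z.re : ℂ) (fun i => ((ζ i).re : ℂ)) W y := by
  rw [borderIntegrand, borderIntegrand, norm_mul, Complex.norm_exp]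
  have h : (-(2 * (ζ ⬝ᵥ fun i => (y.1 i : ℂ)))).re = -(2 * ∑ i, (ζ i).re * y.1 i) := by
    simp [dotProduct]
  rw [h, Complex.ofReal_mul]
  congr 1
  · simp [dotProduct]
  · by_cases hy : y.1 ⬝ᵥ W⁻¹ *ᵥ y.1 < y.2
    · simp only [Set.indicator, Set.mem_Ioi, hy, if_true]
      rw [norm_mul, Complex.norm_exp, Complex.norm_real,
        Real.norm_of_nonneg (Real.rpow_nonneg (sub_pos.2 hy).le _)]
      simp
    · simp [Set.indicator, hy]

lemma integral_borderIntegrand_corner {c : ℝ} (hc : 0 < c) {z : ℂ} (hz : 0 < z.re)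
    (ζ : Fin p → ℂ) (W : Matrix (Fin p) (Fin p) ℝ) (v : Fin p → ℝ) :
    Integrable (fun s => borderIntegrand c z ζ W (v, s)) ∧
      ∫ s, borderIntegrand c z ζ W (v, s) =
        Complex.Gamma c * z ^ (-(c : ℂ)) * gaussianIntegrand z ζ W v := by
  refine ⟨(integrable_indicator_shifted_gamma hc hz (v ⬝ᵥ W⁻¹ *ᵥ v)).const_mul
    (Complex.exp (-(2 * (ζ ⬝ᵥ fun i => (v i : ℂ))))), ?_⟩
  simp only [borderIntegrand]
  rw [integral_const_mul, integral_indicator_shifted_gamma hc hz, gaussianIntegrand, sub_eq_add_neg,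
    Complex.exp_add]
  ring

lemma integrable_borderIntegrand {c : ℝ} (hc : 0 < c) {z : ℂ} (hz : 0 < z.re)
    (ζ : Fin p → ℂ) {W : Matrix (Fin p) (Fin p) ℝ} (hW : W.PosDef) :
    Integrable (borderIntegrand c z ζ W) := by
  refine (integrable_prod_iff
    (measurable_borderIntegrand c z ζ W).aestronglyMeasurable).2
    ⟨Filter.Eventually.of_forall fun v => (integral_borderIntegrand_corner hc hz ζ W v).1, ?_⟩
  have hz' : 0 < (z.re : ℂ).re := by simpa using hz
  have h := ((integrable_gaussianIntegrand hz' (fun i => ((ζ i).re : ℂ)) hW).const_mul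
    (Complex.Gamma c * (z.re : ℂ) ^ (-(c : ℂ)))).re
  refine h.congr (Filter.Eventually.of_forall fun v => ?_)
  have e := (integral_borderIntegrand_corner hc hz' (fun i => ((ζ i).re : ℂ)) W v).2
  simp only [← ofReal_norm_borderIntegrand] at e
  rw [integral_complex_ofReal] at e
  simp only [← e]
  exact Complex.ofReal_re _

lemma integral_borderIntegrand {c : ℝ} (hc : 0 < c) {z : ℂ} (hz : 0 < z.re)
    (ζ : Fin p → ℂ) {W : Matrix (Fin p) (Fin p) ℝ} (hW : W.PosDef) :
    ∫ y, borderIntegrand c z ζ W y = Complex.Gamma c * z ^ (-(c : ℂ)) *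
      (((W.det ^ (1 / 2 : ℝ) : ℝ) : ℂ) * ((Real.pi / z) ^ (p / 2 : ℂ) *
        Complex.exp ((vecMulVec ζ ζ * toComplex W).trace / z))) := by
  have := integral_prod _ (integrable_borderIntegrand hc hz ζ hW)
  rw [← integral_gaussianIntegrand hz ζ hW, ← integral_const_mul]
  refine this.trans (integral_congr_ae (Filter.Eventually.of_forall fun v => ?_))
  exact (integral_borderIntegrand_corner hc hz ζ W v).2

/-- The Laplace integrand of a bordered matrix, extended by zero. -/
def splitIntegrand (N : ℕ) (Z : Matrix (Fin (p + 1)) (Fin (p + 1)) ℂ)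
    (y : (UpperIndex p → ℝ) × ((Fin p → ℝ) × ℝ)) : ℂ :=
  (posDefCone (p + 1)).indicator (fun x => laplaceIntegrand N Z (symMatrix x)) (borderEquiv p y)

lemma mem_posDefCone_borderEquiv (w : UpperIndex p → ℝ) (v : Fin p → ℝ) (s : ℝ) :
    borderEquiv p (w, v, s) ∈ posDefCone (p + 1) ↔
      w ∈ posDefCone p ∧ v ⬝ᵥ (symMatrix w)⁻¹ *ᵥ v < s := by
  simp only [posDefCone, Set.mem_ofPred_eq, symMatrix_borderEquiv, posDef_bordered_iff]

/-- Here det X = det W · (s - v·W⁻¹v). The exponent N/2 - (p+2)/2 of a matrix of size p + 1 is c - 1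
with c = N/2 - p/2, the parameter of the corner integral. -/
lemma splitIntegrand_of_mem (N : ℕ) (z : ℂ) (ζ : Fin p → ℂ) (Y : Matrix (Fin p) (Fin p) ℂ)
    {w : UpperIndex p → ℝ} (hw : w ∈ posDefCone p) (y : (Fin p → ℝ) × ℝ) :
    splitIntegrand N (bordered z ζ Y) (w, y) =
      ((((symMatrix w).det ^ ((N : ℝ) / 2 - (p : ℝ) / 2 - 1) : ℝ) : ℂ) *
        Complex.exp (-(Y * toComplex (symMatrix w)).trace)) *
        borderIntegrand ((N : ℝ) / 2 - (p : ℝ) / 2) z ζ (symMatrix w) y := by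
  obtain ⟨v, s⟩ := y
  have hW : (symMatrix w).PosDef := hw
  rw [splitIntegrand, borderIntegrand]
  by_cases hs : v ⬝ᵥ (symMatrix w)⁻¹ *ᵥ v < s
  · rw [Set.indicator_of_mem ((mem_posDefCone_borderEquiv w v s).2 ⟨hw, hs⟩),
      Set.indicator_of_mem (show s ∈ Set.Ioi _ from hs), laplaceIntegrand, symMatrix_borderEquiv,
      det_bordered_of_block _ _ hW.det_pos.ne'.isUnit,
      Real.mul_rpow hW.det_pos.le (sub_pos.2 hs).le, toComplex, bordered_map,
      trace_bordered_mul_bordered]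
    have e : (N : ℝ) / 2 - (((p + 1 : ℕ) : ℝ) + 1) / 2 = (N : ℝ) / 2 - (p : ℝ) / 2 - 1 := by
      push_cast; ring
    rw [e, neg_add, neg_add, Complex.exp_add, Complex.exp_add]
    simp only [toComplex, Function.comp_def]
    push_cast
    ring
  · rw [Set.indicator_of_notMem (fun h => hs ((mem_posDefCone_borderEquiv w v s).1 h).2),
      Set.indicator_of_notMem (show s ∉ Set.Ioi _ from hs), mul_zero, mul_zero]

lemma splitIntegrand_of_notMem (N : ℕ) (Z : Matrix (Fin (p + 1)) (Fin (p + 1)) ℂ)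
    {w : UpperIndex p → ℝ} (hw : w ∉ posDefCone p) (y : (Fin p → ℝ) × ℝ) :
    splitIntegrand N Z (w, y) = 0 :=
  Set.indicator_of_notMem (fun h => hw ((mem_posDefCone_borderEquiv w y.1 y.2).1 h).1) _

/-- The constant produced by integrating out the border and the corner. -/
def borderConstant (N p : ℕ) (z : ℂ) : ℂ :=
  Complex.Gamma (((N : ℝ) / 2 - (p : ℝ) / 2 : ℝ) : ℂ) *
    z ^ (-(((N : ℝ) / 2 - (p : ℝ) / 2 : ℝ) : ℂ)) * (Real.pi / z) ^ (p / 2 : ℂ)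

lemma integral_splitIntegrand_fiber {N : ℕ} (hN : p + 1 ≤ N) {z : ℂ} {ζ : Fin p → ℂ}
    {Y : Matrix (Fin p) (Fin p) ℂ} (hz : 0 < z.re) (w : UpperIndex p → ℝ) :
    Integrable (fun y => splitIntegrand N (bordered z ζ Y) (w, y)) ∧
      ∫ y, splitIntegrand N (bordered z ζ Y) (w, y) =
        (posDefCone p).indicator (fun w => borderConstant N p z *
          laplaceIntegrand N (Y - z⁻¹ • vecMulVec ζ ζ) (symMatrix w)) w := by
  have hc : 0 < (N : ℝ) / 2 - (p : ℝ) / 2 := by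
    have : (p : ℝ) + 1 ≤ N := by exact_mod_cast hN
    linarith
  by_cases hw : w ∈ posDefCone p
  · have hW : (symMatrix w).PosDef := hw
    simp only [splitIntegrand_of_mem N z ζ Y hw]
    refine ⟨(integrable_borderIntegrand hc hz ζ hW).const_mul _, ?_⟩
    rw [integral_const_mul, integral_borderIntegrand hc hz ζ hW, Set.indicator_of_mem hw,
      laplaceIntegrand, borderConstant, Matrix.sub_mul, trace_sub, Matrix.smul_mul, trace_smul,
      smul_eq_mul, neg_sub, sub_eq_add_neg (z⁻¹ * _), Complex.exp_add,
      -- The factor (det W)^(1/2) of the Gaussian integral supplies the missing 1/2 in the exponent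
      -- for size p; its exponential shifts Y to the Schur complement.
      show (N : ℝ) / 2 - ((p : ℝ) + 1) / 2 = ((N : ℝ) / 2 - (p : ℝ) / 2 - 1) + 1 / 2 by ring,
      Real.rpow_add hW.det_pos, div_eq_inv_mul _ z]
    push_cast
    ring_nf
  · simp [splitIntegrand_of_notMem N _ hw, hw]

lemma ofReal_norm_splitIntegrand (N : ℕ) (Z : Matrix (Fin (p + 1)) (Fin (p + 1)) ℂ)
    (y : (UpperIndex p → ℝ) × ((Fin p → ℝ) × ℝ)) :
    (‖splitIntegrand N Z y‖ : ℂ) = splitIntegrand N (toComplex (Z.map Complex.re)) y := by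
  rw [splitIntegrand, splitIntegrand]
  by_cases h : borderEquiv p y ∈ posDefCone (p + 1)
  · rw [Set.indicator_of_mem h, Set.indicator_of_mem h]
    exact ofReal_norm_laplaceIntegrand N Z h
  · simp [h]

lemma integrable_splitIntegrand {N : ℕ} (hN : p + 1 ≤ N)
    (ih : ∀ S : Matrix (Fin p) (Fin p) ℂ, Accretive S → ConeIntegrable (laplaceIntegrand N S))
    {z : ℂ} {ζ : Fin p → ℂ} {Y : Matrix (Fin p) (Fin p) ℂ} (hZ : Accretive (bordered z ζ Y)) :
    Integrable (splitIntegrand N (bordered z ζ Y)) := by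
  have hmeas : AEStronglyMeasurable (splitIntegrand N (bordered z ζ Y)) :=
    (((measurable_laplaceIntegrand N (bordered z ζ Y)).indicator
      measurableSet_posDefCone).comp (borderEquiv p).measurable).aestronglyMeasurable
  refine (integrable_prod_iff hmeas).2 ⟨Filter.Eventually.of_forall fun w =>
    (integral_splitIntegrand_fiber hN hZ.corner w).1, ?_⟩
  have hre := hZ.toComplex_re
  rw [bordered_map, toComplex, bordered_map] at hre
  have h := ((integrable_indicator_iff measurableSet_posDefCone).2
    ((ih _ hre.schur).const_mul (borderConstant N p ((z.re : ℝ) : ℂ)))).re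
  refine h.congr (Filter.Eventually.of_forall fun w => ?_)
  have e := (integral_splitIntegrand_fiber (ζ := Complex.ofReal ∘ Complex.re ∘ ζ)
    (Y := (Y.map Complex.re).map Complex.ofReal) hN hre.corner w).2
  have e2 := fun y => ofReal_norm_splitIntegrand N (bordered z ζ Y) (w, y)
  simp only [bordered_map, toComplex] at e2
  simp only [← e2] at e
  rw [integral_complex_ofReal] at e
  simp only [← e]
  exact Complex.ofReal_re _

lemma laplace_step {N : ℕ} (hN : p + 1 ≤ N)
    (ih : ∀ S : Matrix (Fin p) (Fin p) ℂ, Accretive S → ConeIntegrable (laplaceIntegrand N S))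
    {z : ℂ} {ζ : Fin p → ℂ} {Y : Matrix (Fin p) (Fin p) ℂ} (hZ : Accretive (bordered z ζ Y)) :
    ConeIntegrable (laplaceIntegrand N (bordered z ζ Y)) ∧
      coneIntegral (laplaceIntegrand N (bordered z ζ Y)) =
        borderConstant N p z *
          coneIntegral (laplaceIntegrand N (Y - z⁻¹ • vecMulVec ζ ζ)) := by
  have hint := integrable_splitIntegrand hN ih hZ
  constructor
  · rw [ConeIntegrable, ← integrable_indicator_iff measurableSet_posDefCone]
    exact ((measurePreserving_borderEquiv p).integrable_comp_emb
      (borderEquiv p).measurableEmbedding).1 hint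
  · rw [coneIntegral, ← integral_indicator measurableSet_posDefCone,
      ← (measurePreserving_borderEquiv p).integral_comp (borderEquiv p).measurableEmbedding]
    refine (integral_prod _ hint).trans ?_
    simp only [(integral_splitIntegrand_fiber hN hZ.corner _).2]
    rw [integral_indicator measurableSet_posDefCone, integral_const_mul]
    rfl

/-- After squaring, the powers of z are z^(-(N-p)) and z^(-p), both integral, so no branch has to be
compared. -/
lemma borderConstant_sq {N : ℕ} (hN : p + 1 ≤ N) {z : ℂ} (hz : z ≠ 0) :
    borderConstant N p z ^ 2 * z ^ N = borderConstant N p 1 ^ 2 := by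
  have h1 : (z ^ (-(((N : ℝ) / 2 - (p : ℝ) / 2 : ℝ) : ℂ))) ^ 2 = (z ^ (N - p))⁻¹ := by
    rw [← Complex.cpow_nat_mul, ← Complex.cpow_natCast z, ← Complex.cpow_neg]
    congr 1
    push_cast [Nat.cast_sub (show p ≤ N by omega)]
    ring
  have h2 : ∀ w : ℂ, (w ^ (p / 2 : ℂ)) ^ 2 = w ^ p := by
    intro w
    rw [← Complex.cpow_nat_mul, ← Complex.cpow_natCast w]
    congr 1
    push_cast
    ring
  rw [borderConstant, borderConstant, mul_pow, mul_pow, h1, h2, mul_pow, mul_pow, h2,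
    Complex.one_cpow, div_pow, div_one, one_pow, mul_one]
  have h3 : z ^ N = z ^ (N - p) * z ^ p := by rw [← pow_add]; congr 1; omega
  rw [h3]
  field_simp

end Laplace

/-! ### The square of the Laplace transform, by induction on the size. -/

section LaplaceSquare

lemma laplace_integrable_and_sq (p : ℕ) : ∀ N : ℕ, p ≤ N →
    (∀ Z : Matrix (Fin p) (Fin p) ℂ, Accretive Z → ConeIntegrable (laplaceIntegrand N Z)) ∧
    ∃ C : ℂ, ∀ Z : Matrix (Fin p) (Fin p) ℂ, Accretive Z →
      coneIntegral (laplaceIntegrand N Z) ^ 2 * Z.det ^ N = C := by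
  induction p with
  -- For p = 0 the coordinate space is a point and there is only one matrix.
  | zero =>
    intro N _
    constructor
    · intro Z _
      have : IsFiniteMeasure (volume.restrict (posDefCone 0)) := inferInstance
      exact Integrable.of_finite
    · exact ⟨_, fun Z _ => by rw [Subsingleton.elim Z 1]⟩
  | succ p ih =>
    intro N hN
    obtain ⟨ih1, C, hC⟩ := ih N (by omega)
    constructor
    · intro Z hZ
      have e := eq_bordered hZ.symm
      rw [e] at hZ
      rw [e]
      exact (laplace_step hN ih1 hZ).1
    · refine ⟨borderConstant N p 1 ^ 2 * C, fun Z hZ => ?_⟩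
      have e := eq_bordered hZ.symm
      rw [e] at hZ
      rw [e]
      have hz : Z 0 0 ≠ 0 := by
        intro h
        have := hZ.corner
        rw [h] at this
        exact lt_irrefl _ this
      rw [(laplace_step hN ih1 hZ).2, det_bordered_of_corner hz, mul_pow, mul_pow,
        ← borderConstant_sq hN hz, ← hC _ hZ.schur]
      ring

variable {p N : ℕ}

lemma coneIntegrable_laplaceIntegrand (hN : p ≤ N) {Z : Matrix (Fin p) (Fin p) ℂ}
    (hZ : Accretive Z) : ConeIntegrable (laplaceIntegrand N Z) :=
  (laplace_integrable_and_sq p N hN).1 Z hZ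

lemma accretive_smul_one {c : ℝ} (hc : 0 < c) :
    Accretive ((c : ℂ) • (1 : Matrix (Fin p) (Fin p) ℂ)) := by
  refine ⟨(Matrix.isSymm_one).smul _, ?_⟩
  have : ((c : ℂ) • (1 : Matrix (Fin p) (Fin p) ℂ)).map Complex.re = c • 1 := by
    ext i j
    by_cases h : i = j <;> simp [h]
  rw [this]
  exact PosDef.one.smul hc

lemma coneIntegral_laplaceIntegrand_one :
    coneIntegral (laplaceIntegrand N (1 : Matrix (Fin p) (Fin p) ℂ)) =
      multivariateGamma p ((N : ℂ) / 2) := by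
  rw [multivariateGamma, coneIntegral, coneIntegral]
  refine setIntegral_congr_fun measurableSet_posDefCone fun x hx => ?_
  have hx : (symMatrix x).PosDef := hx
  simp only [laplaceIntegrand, etr, Matrix.one_mul, trace_neg]
  rw [mul_comm, Complex.ofReal_cpow hx.det_pos.le]
  push_cast
  rfl

lemma laplace_sq (hN : p ≤ N) {Z : Matrix (Fin p) (Fin p) ℂ} (hZ : Accretive Z) :
    coneIntegral (laplaceIntegrand N Z) ^ 2 * Z.det ^ N = multivariateGamma p ((N : ℂ) / 2) ^ 2 := by
  obtain ⟨-, C, hC⟩ := laplace_integrable_and_sq p N hN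
  have h1 : Accretive (1 : Matrix (Fin p) (Fin p) ℂ) := by
    simpa using accretive_smul_one (p := p) one_pos
  have := hC 1 h1
  rw [det_one, one_pow, mul_one, coneIntegral_laplaceIntegrand_one] at this
  rw [this, hC Z hZ]

end LaplaceSquare

/-! ### Trace inequalities on the cone. -/

section TraceBounds

variable {p : ℕ}

/-- Testing the form on e_i ± e_j gives 2|X_ij| ≤ X_ii + X_jj. -/
lemma abs_apply_le_trace {X : Matrix (Fin p) (Fin p) ℝ} (hX : X.PosSemidef) (i j : Fin p) :
    |X i j| ≤ X.trace := by
  have hdiag : ∀ k, X k k ≤ X.trace := fun k =>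
    Finset.single_le_sum (f := fun k => X k k) (fun l _ => hX.diag_nonneg) (Finset.mem_univ k)
  have hs : X j i = X i j := by simpa using hX.1.apply i j
  have h1 := hX.dotProduct_mulVec_nonneg (Pi.single i 1 + Pi.single j 1)
  have h2 := hX.dotProduct_mulVec_nonneg (Pi.single i 1 - Pi.single j 1)
  simp only [star_trivial, mulVec_add, mulVec_sub, add_dotProduct, sub_dotProduct, dotProduct_add,
    dotProduct_sub, mulVec_single_one, single_one_dotProduct, col_apply, hs] at h1 h2
  have hi := hdiag i
  have hj := hdiag j
  rw [abs_le]
  constructor <;> linarith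

/-- Congruence by B, where U = B Bᵀ, reduces to U = 1, where entries are bounded by the trace.
Applied with U = Re Z: taking V = Im Z confines tr ZX to a sector, and V = 1 bounds Re tr ZX below
by a multiple of tr X. -/
lemma exists_abs_trace_mul_le {U : Matrix (Fin p) (Fin p) ℝ} (hU : U.PosDef)
    (V : Matrix (Fin p) (Fin p) ℝ) :
    ∃ K : ℝ, 1 ≤ K ∧ ∀ X : Matrix (Fin p) (Fin p) ℝ, X.PosSemidef →
      |(V * X).trace| ≤ K * (U * X).trace := by
  obtain ⟨B, rfl, hB⟩ := exists_eq_mul_transpose hU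
  let V' := B⁻¹ * V * Bᵀ⁻¹
  refine ⟨1 + ∑ i, ∑ j, |V' i j|, le_add_of_nonneg_right (by positivity), fun X hX => ?_⟩
  have hu : IsUnit B.det := hB.isUnit
  have hut : IsUnit Bᵀ.det := by rwa [det_transpose]
  have hX' : (Bᵀ * X * B).PosSemidef := by
    have := hX.conjTranspose_mul_mul_same B
    rwa [conjTranspose_eq_transpose_of_trivial] at this
  have h1 : (V * X).trace = (V' * (Bᵀ * X * B)).trace := by
    have : V' * (Bᵀ * X * B) = B⁻¹ * (V * X * B) := by
      simp only [V', Matrix.mul_assoc]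
      rw [← Matrix.mul_assoc Bᵀ⁻¹, Matrix.nonsing_inv_mul _ hut, Matrix.one_mul]
    rw [this, trace_mul_comm B⁻¹, Matrix.mul_assoc (V * X), Matrix.mul_nonsing_inv _ hu,
      Matrix.mul_one]
  have h2 : (B * Bᵀ * X).trace = (Bᵀ * X * B).trace := by
    rw [Matrix.mul_assoc, trace_mul_comm]
  rw [h1, h2]
  have h0 : 0 ≤ (Bᵀ * X * B).trace := hX'.trace_nonneg
  calc |(V' * (Bᵀ * X * B)).trace|
      ≤ ∑ i, ∑ j, |V' i j * (Bᵀ * X * B) j i| := by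
        rw [Matrix.trace]
        simp only [Matrix.diag, Matrix.mul_apply (M := V')]
        exact (Finset.abs_sum_le_sum_abs _ _).trans
          (Finset.sum_le_sum fun i _ => Finset.abs_sum_le_sum_abs _ _)
    _ ≤ ∑ i, ∑ j, |V' i j| * (Bᵀ * X * B).trace := by
        refine Finset.sum_le_sum fun i _ => Finset.sum_le_sum fun j _ => ?_
        rw [abs_mul]
        exact mul_le_mul_of_nonneg_left (abs_apply_le_trace hX' j i) (abs_nonneg _)
    _ = (∑ i, ∑ j, |V' i j|) * (Bᵀ * X * B).trace := by
        simp only [Finset.sum_mul]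
    _ ≤ (1 + ∑ i, ∑ j, |V' i j|) * (Bᵀ * X * B).trace := by
        gcongr
        linarith

lemma trace_im (Z : Matrix (Fin p) (Fin p) ℂ) (X : Matrix (Fin p) (Fin p) ℝ) :
    (Z * toComplex X).trace.im = (Z.map Complex.im * X).trace := by
  simp [Matrix.trace, Matrix.mul_apply, toComplex]

lemma Accretive.re_trace_nonneg {Z : Matrix (Fin p) (Fin p) ℂ} (hZ : Accretive Z)
    {X : Matrix (Fin p) (Fin p) ℝ} (hX : X.PosSemidef) : 0 ≤ (Z * toComplex X).trace.re := by
  obtain ⟨K, hK, h⟩ := exists_abs_trace_mul_le hZ.re_posDef 1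
  rw [trace_re]
  exact nonneg_of_mul_nonneg_right ((abs_nonneg _).trans (h X hX)) (by linarith)

lemma Accretive.exists_norm_trace_le {Z : Matrix (Fin p) (Fin p) ℂ} (hZ : Accretive Z) :
    ∃ K : ℝ, 1 ≤ K ∧ ∀ X : Matrix (Fin p) (Fin p) ℝ, X.PosSemidef →
      ‖(Z * toComplex X).trace‖ ≤ K * (Z * toComplex X).trace.re := by
  obtain ⟨K, hK, h⟩ := exists_abs_trace_mul_le hZ.re_posDef (Z.map Complex.im)
  refine ⟨1 + K, by linarith, fun X hX => ?_⟩
  have h1 := h X hX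
  have h2 := hZ.re_trace_nonneg hX
  rw [← trace_im, ← trace_re] at h1
  have h3 := Complex.norm_le_abs_re_add_abs_im (Z * toComplex X).trace
  rw [abs_of_nonneg h2] at h3
  linarith

lemma Accretive.re_trace_pos (hp : 1 ≤ p) {Z : Matrix (Fin p) (Fin p) ℂ} (hZ : Accretive Z)
    {X : Matrix (Fin p) (Fin p) ℝ} (hX : X.PosDef) : 0 < (Z * toComplex X).trace.re := by
  obtain ⟨K, hK, h⟩ := exists_abs_trace_mul_le hZ.re_posDef 1
  have : Nonempty (Fin p) := ⟨⟨0, hp⟩⟩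
  have h1 := h X hX.posSemidef
  rw [Matrix.one_mul, abs_of_pos hX.trace_pos] at h1
  rw [trace_re]
  exact pos_of_mul_pos_right (hX.trace_pos.trans_le h1) (by linarith)

end TraceBounds

/-! ### Choice of the branch along a segment. -/

section Branch

variable {p N : ℕ}

/-- The segment from the identity matrix to `Z`. -/
def segmentToOne (Z : Matrix (Fin p) (Fin p) ℂ) (w : ℝ) : Matrix (Fin p) (Fin p) ℂ :=
  ((1 - w : ℝ) : ℂ) • 1 + (w : ℂ) • Z

lemma Accretive.segment {Z : Matrix (Fin p) (Fin p) ℂ} (hZ : Accretive Z) {w : ℝ}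
    (hw : w ∈ Set.Icc (0 : ℝ) 1) : Accretive (segmentToOne Z w) := by
  rcases eq_or_lt_of_le hw.1 with h0 | h0
  · rw [← h0]
    simpa [segmentToOne] using accretive_smul_one (p := p) one_pos
  refine ⟨((Matrix.isSymm_one).smul _).add (hZ.symm.smul _), ?_⟩
  have : (segmentToOne Z w).map Complex.re = (1 - w) • 1 + w • Z.map Complex.re := by
    ext i j
    by_cases h : i = j <;> simp [segmentToOne, h]
  rw [this]
  exact PosDef.posSemidef_add (PosSemidef.one.smul (sub_nonneg.2 hw.2)) (hZ.re_posDef.smul h0)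

lemma re_trace_segmentToOne (Z : Matrix (Fin p) (Fin p) ℂ) (w : ℝ)
    (X : Matrix (Fin p) (Fin p) ℝ) :
    (segmentToOne Z w * toComplex X).trace.re =
      (1 - w) * X.trace + w * (Z * toComplex X).trace.re := by
  rw [segmentToOne, Matrix.add_mul, Matrix.smul_mul, Matrix.smul_mul, trace_add, trace_smul,
    trace_smul, Complex.add_re, smul_eq_mul, smul_eq_mul, Complex.re_ofReal_mul,
    Complex.re_ofReal_mul, trace_re 1]
  congr 3
  ext i j
  by_cases h : i = j <;> simp [Matrix.one_apply, h, Matrix.mul_apply]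

lemma norm_laplaceIntegrand (Z : Matrix (Fin p) (Fin p) ℂ) (X : Matrix (Fin p) (Fin p) ℝ) :
    ‖laplaceIntegrand N Z X‖ = ‖((X.det ^ ((N : ℝ) / 2 - ((p : ℝ) + 1) / 2) : ℝ) : ℂ)‖ *
      Real.exp (-(Z * toComplex X).trace.re) := by
  rw [laplaceIntegrand, norm_mul, Complex.norm_exp, Complex.neg_re]

/-- Along the whole segment the real part of the trace is at least K⁻¹ tr X, so the integrand at K⁻¹
· 1 dominates. -/
lemma continuousOn_coneIntegral_segmentToOne (hN : p ≤ N) {Z : Matrix (Fin p) (Fin p) ℂ}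
    (hZ : Accretive Z) :
    ContinuousOn (fun w => coneIntegral (laplaceIntegrand N (segmentToOne Z w)))
      (Set.Icc (0 : ℝ) 1) := by
  obtain ⟨K, hK, h⟩ := exists_abs_trace_mul_le hZ.re_posDef 1
  have hK0 : 0 < K := by linarith
  refine continuousOn_of_dominated
    (bound := fun x => ‖laplaceIntegrand N (((K⁻¹ : ℝ) : ℂ) • 1) (symMatrix x)‖) ?_ ?_ ?_ ?_
  · exact fun w _ => (measurable_laplaceIntegrand N _).aestronglyMeasurable
  · intro w hw
    filter_upwards [ae_restrict_mem measurableSet_posDefCone] with x hx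
    have hx : (symMatrix x).PosDef := hx
    rw [norm_laplaceIntegrand, norm_laplaceIntegrand]
    refine mul_le_mul_of_nonneg_left (Real.exp_le_exp.2 (neg_le_neg ?_)) (norm_nonneg _)
    have h1 := h _ hx.posSemidef
    have h0 : 0 ≤ (symMatrix x).trace := hx.posSemidef.trace_nonneg
    rw [Matrix.one_mul, abs_of_nonneg h0, ← trace_re] at h1
    have h2 : K⁻¹ * (symMatrix x).trace ≤ (Z * toComplex (symMatrix x)).trace.re := by
      rwa [inv_mul_le_iff₀ hK0]
    have h3 : K⁻¹ * (symMatrix x).trace ≤ (symMatrix x).trace :=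
      mul_le_of_le_one_left h0 (inv_le_one_of_one_le₀ hK)
    have h4 : (((K⁻¹ : ℝ) : ℂ) • (1 : Matrix (Fin p) (Fin p) ℂ) *
        toComplex (symMatrix x)).trace.re = K⁻¹ * (symMatrix x).trace := by
      rw [Matrix.smul_mul, trace_smul, smul_eq_mul, Complex.re_ofReal_mul, Matrix.one_mul]
      simp [Matrix.trace, toComplex]
    rw [h4, re_trace_segmentToOne]
    have e1 := mul_le_mul_of_nonneg_left h3 (sub_nonneg.2 hw.2)
    have e2 := mul_le_mul_of_nonneg_left h2 hw.1
    linarith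
  · exact (coneIntegrable_laplaceIntegrand hN (accretive_smul_one (inv_pos.2 hK0))).norm
  · refine Filter.Eventually.of_forall fun x => Continuous.continuousOn ?_
    unfold laplaceIntegrand segmentToOne
    have : Continuous fun w : ℝ => ((((1 - w : ℝ) : ℂ) • (1 : Matrix (Fin p) (Fin p) ℂ) +
        (w : ℂ) • Z) * toComplex (symMatrix x)).trace := by
      refine (Continuous.matrix_mul ?_ continuous_const).matrix_trace
      fun_prop
    fun_prop

/-- For an eigenvector v, the form of Z at v is l times the positive number |v|². -/
lemma Accretive.re_root_pos {Z : Matrix (Fin p) (Fin p) ℂ} (hZ : Accretive Z) {l : ℂ}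
    (hl : l ∈ Z.charpoly.roots) : 0 < l.re := by
  have h1 : (scalar (Fin p) l - Z).det = 0 := by
    rw [← Matrix.eval_charpoly]
    exact (Polynomial.mem_roots'.1 hl).2
  obtain ⟨v, hv, h2⟩ := Matrix.exists_mulVec_eq_zero_iff.2 h1
  have h3 : Z *ᵥ v = l • v := by
    rw [sub_mulVec, sub_eq_zero] at h2
    rw [← h2]
    simp [scalar_apply, ← Matrix.smul_one_eq_diagonal, smul_mulVec]
  have h4 := hZ.re_pos hv
  rw [h3, dotProduct_smul, smul_eq_mul] at h4
  have h5 : star v ⬝ᵥ v = ((∑ i, Complex.normSq (v i) : ℝ) : ℂ) := by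
    simp [dotProduct, Complex.normSq_eq_conj_mul_self]
  rw [h5, mul_comm, Complex.re_ofReal_mul] at h4
  exact pos_of_mul_pos_right h4 (Finset.sum_nonneg fun i _ => Complex.normSq_nonneg _)

lemma det_segmentToOne (Z : Matrix (Fin p) (Fin p) ℂ) (w : ℝ) :
    (segmentToOne Z w).det = (Z.charpoly.roots.map fun l => 1 + (w : ℂ) * (l - 1)).prod := by
  have hcard : Multiset.card Z.charpoly.roots = p := by
    rw [IsAlgClosed.card_roots_eq_natDegree, charpoly_natDegree_eq_dim, Fintype.card_fin]
  by_cases hw : (w : ℂ) = 0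
  · have : w = 0 := by exact_mod_cast hw
    subst this
    simp [segmentToOne]
  -- The segment point is -w (m - Z), so its determinant is a multiple of the characteristic
  -- polynomial at m.
  · let m : ℂ := -((1 - w) / w)
    have h1 : segmentToOne Z w = (-(w : ℂ)) • (scalar (Fin p) m - Z) := by
      ext i j
      by_cases h : i = j
      · simp [segmentToOne, h, scalar_apply, m]
        field_simp
        ring
      · simp [segmentToOne, h, scalar_apply]
    have h2 : Z.charpoly.eval m = (Z.charpoly.roots.map fun l => m - l).prod := by
      conv_lhs => rw [(IsAlgClosed.splits Z.charpoly).eq_prod_roots_of_monic (charpoly_monic Z)]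
      simp [Polynomial.eval_multiset_prod]
    rw [h1, det_smul, Fintype.card_fin, ← Matrix.eval_charpoly, h2]
    nth_rewrite 1 [← hcard]
    rw [← Multiset.prod_replicate, ← Multiset.map_const', ← Multiset.prod_map_mul]
    congr 1
    refine Multiset.map_congr rfl fun l _ => ?_
    simp only [m]
    field_simp
    ring

lemma coneIntegral_laplaceIntegrand (hN : p ≤ N) {Z : Matrix (Fin p) (Fin p) ℂ}
    (hZ : Accretive Z) :
    coneIntegral (laplaceIntegrand N Z) =
      multivariateGamma p ((N : ℂ) / 2) * detPow Z (-((N : ℂ) / 2)) := by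
  -- The product is a continuous branch of det^(N/2) on the segment, since every factor stays in the
  -- right half-plane. So g is continuous with constant square.
  let g : ℝ → ℂ := fun w => coneIntegral (laplaceIntegrand N (segmentToOne Z w)) *
    (Z.charpoly.roots.map fun l => (1 + (w : ℂ) * (l - 1)) ^ ((N : ℂ) / 2)).prod
  have hre : ∀ l ∈ Z.charpoly.roots, ∀ w ∈ Set.Icc (0 : ℝ) 1, 0 < (1 + (w : ℂ) * (l - 1)).re := by
    intro l hl w hw
    have hl := hZ.re_root_pos hl
    rw [Complex.add_re, Complex.re_ofReal_mul, Complex.sub_re, Complex.one_re]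
    rcases eq_or_lt_of_le hw.1 with h0 | h0
    · rw [← h0]; norm_num
    · nlinarith [mul_pos h0 hl, hw.2]
  have hcont : ContinuousOn g (Set.Icc 0 1) := by
    refine (continuousOn_coneIntegral_segmentToOne hN hZ).mul ?_
    refine continuousOn_multiset_prod _ fun l hl => ?_
    refine ContinuousOn.cpow_const (by fun_prop) fun w hw => Or.inl (hre l hl w hw)
  have hsq : ∀ w ∈ Set.Icc (0 : ℝ) 1, g w ^ 2 = multivariateGamma p ((N : ℂ) / 2) ^ 2 := by
    intro w hw
    rw [← laplace_sq hN (hZ.segment hw), det_segmentToOne, mul_pow, ← Multiset.prod_map_pow,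
      ← Multiset.prod_map_pow]
    congr 2
    refine Multiset.map_congr rfl fun l _ => ?_
    rw [← Complex.cpow_nat_mul, ← Complex.cpow_natCast]
    congr 1
    push_cast
    ring
  have h0 : g 0 = multivariateGamma p ((N : ℂ) / 2) := by
    simp [g, segmentToOne, coneIntegral_laplaceIntegrand_one]
  have h1 : g 1 = multivariateGamma p ((N : ℂ) / 2) := by
    -- If the constant is zero then g vanishes; otherwise a continuous square root on an interval is
    -- determined by its value at 0. Nonvanishing of Γ_p is thus not needed.
    by_cases hC : multivariateGamma p ((N : ℂ) / 2) = 0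
    · have := hsq 1 ⟨zero_le_one, le_rfl⟩
      rw [hC] at this ⊢
      simpa using this
    · exact isPreconnected_Icc.eq_of_sq_eq hcont continuousOn_const (fun w hw => hsq w hw)
        (fun _ => hC) (y := 0) ⟨le_rfl, zero_le_one⟩ h0 ⟨zero_le_one, le_rfl⟩
  have hP : detPow Z (-((N : ℂ) / 2)) =
      ((Z.charpoly.roots.map fun l => l ^ ((N : ℂ) / 2)).prod)⁻¹ := by
    rw [detPow, ← Multiset.prod_map_inv]
    simp only [Complex.cpow_neg]
  have hne : (Z.charpoly.roots.map fun l => l ^ ((N : ℂ) / 2)).prod ≠ 0 := by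
    refine Multiset.prod_ne_zero fun h => ?_
    obtain ⟨l, hl, h⟩ := Multiset.mem_map.1 h
    rw [Complex.cpow_eq_zero_iff] at h
    have := hZ.re_root_pos hl
    rw [h.1] at this
    exact lt_irrefl _ this
  rw [hP, ← h1, eq_mul_inv_iff_mul_eq₀ hne]
  simp [g, segmentToOne]

end Branch

/-- Both arguments are below π/2 in absolute value, so their sum stays in the principal range. -/
lemma mul_cpow_of_re_pos {z w : ℂ} (hz : 0 < z.re) (hw : 0 < w.re) (s : ℂ) :
    (z * w) ^ s = z ^ s * w ^ s := by
  have hz0 : z ≠ 0 := by rintro rfl; exact lt_irrefl _ hz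
  have hw0 : w ≠ 0 := by rintro rfl; exact lt_irrefl _ hw
  have h1 := abs_lt.1 (Complex.abs_arg_lt_pi_div_two_iff.2 (Or.inl hz))
  have h2 := abs_lt.1 (Complex.abs_arg_lt_pi_div_two_iff.2 (Or.inl hw))
  rw [Complex.cpow_def_of_ne_zero (mul_ne_zero hz0 hw0), Complex.cpow_def_of_ne_zero hz0,
    Complex.cpow_def_of_ne_zero hw0, (Complex.log_mul_eq_add_log_iff hz0 hw0).2
      ⟨by linarith [h1.1, h2.1], by linarith [h1.2, h2.2]⟩, add_mul, Complex.exp_add]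

/-! ### Homogeneous weights and averaging over dilations. -/

section Homogeneous

open Set Module

section Integrands

variable {E : Type*} (φ Λ : E → ℂ)

/-- The dilation average of a homogeneous integrand, before rescaling the space variable. -/
def dilationIntegrand (σ : ℝ) (y : E × ℝ) : ℂ :=
  {y : E × ℝ | y.2 ≤ (Λ y.1).re ∧ (Λ y.1).re ≤ 2 * y.2}.indicator
    (fun y => φ y.1 * (Complex.exp (-Λ y.1) * Λ y.1 ^ (σ : ℂ)) * ((y.2⁻¹ : ℝ) : ℂ)) y

/-- The restriction of `φ` to the shell `1 ≤ Re Λ ≤ 2`. -/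
def shellPart : E → ℂ :=
  {x | 1 ≤ (Λ x).re ∧ (Λ x).re ≤ 2}.indicator φ

/-- The dilation average of a homogeneous integrand, after rescaling the space variable. -/
def shellIntegrand (s σ : ℝ) (y : E × ℝ) : ℂ :=
  shellPart φ Λ y.1 * Λ y.1 ^ (σ : ℂ) *
    (((y.2 ^ (s - 1) : ℝ) : ℂ) * Complex.exp (-(Λ y.1 * y.2)))

variable {φ Λ}

/-- The admissible u fill [Re Λ/2, Re Λ], of mass log 2 for du/u whatever Λ is. -/
lemma dilationIntegrand_fiber {x : E} (hx : 0 < (Λ x).re) (σ : ℝ) :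
    ∫ u in Ioi (0 : ℝ), dilationIntegrand φ Λ σ (x, u) =
      ((Real.log 2 : ℝ) : ℂ) * (φ x * (Complex.exp (-Λ x) * Λ x ^ (σ : ℂ))) := by
  have hset : ∀ u : ℝ, dilationIntegrand φ Λ σ (x, u) =
      (Icc ((Λ x).re / 2) (Λ x).re).indicator
        (fun u => φ x * (Complex.exp (-Λ x) * Λ x ^ (σ : ℂ)) * ((u⁻¹ : ℝ) : ℂ)) u := by
    intro u
    rw [dilationIntegrand]
    by_cases hu : u ∈ Icc ((Λ x).re / 2) (Λ x).re
    · rw [indicator_of_mem hu, indicator_of_mem]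
      exact ⟨hu.2, by linarith [hu.1]⟩
    · rw [indicator_of_notMem hu, indicator_of_notMem]
      rintro ⟨h1, h2⟩
      exact hu ⟨by linarith, h1⟩
  have hle : (Λ x).re / 2 ≤ (Λ x).re := by linarith
  simp only [hset]
  rw [setIntegral_indicator measurableSet_Icc, inter_eq_self_of_subset_right,
    integral_const_mul, integral_complex_ofReal, integral_Icc_eq_integral_Ioc,
    ← intervalIntegral.integral_of_le hle, integral_inv_of_pos (by linarith) hx, mul_comm]
  · congr 3
    field_simp
  · exact fun u hu => lt_of_lt_of_le (by linarith : (0 : ℝ) < (Λ x).re / 2) hu.1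

/-- The u-integral is a gamma integral with rate Λ. On the shell 1 ≤ |Λ| ≤ 2K, which bounds Λ^σ for
either sign of σ. -/
lemma shellIntegrand_fiber {s K : ℝ} (hs : 0 < s) (hK : 1 ≤ K) (σ : ℝ) (x : E)
    (hx : φ x ≠ 0 → 0 < (Λ x).re ∧ ‖Λ x‖ ≤ K * (Λ x).re) :
    IntegrableOn (fun u => shellIntegrand φ Λ s σ (x, u)) (Ioi 0) ∧
      ∫ u in Ioi (0 : ℝ), shellIntegrand φ Λ s σ (x, u) =
        Complex.Gamma s * (shellPart φ Λ x * Λ x ^ ((σ - s : ℝ) : ℂ)) ∧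
      ∫ u in Ioi (0 : ℝ), ‖shellIntegrand φ Λ s σ (x, u)‖ ≤
        (2 * K) ^ |σ| * Real.Gamma s * ‖shellPart φ Λ x‖ := by
  by_cases h0 : shellPart φ Λ x = 0
  · simp [shellIntegrand, h0]
  obtain ⟨hmem, hφ⟩ : x ∈ {x | 1 ≤ (Λ x).re ∧ (Λ x).re ≤ 2} ∧ φ x ≠ 0 := by
    rw [shellPart, indicator_apply_eq_zero] at h0
    push Not at h0
    exact h0
  obtain ⟨hm1, hm2⟩ : 1 ≤ (Λ x).re ∧ (Λ x).re ≤ 2 := hmem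
  obtain ⟨hpos, hnorm⟩ := hx hφ
  refine ⟨(integrableOn_rpow_mul_cexp_neg hs hpos).const_mul
    (shellPart φ Λ x * Λ x ^ (σ : ℂ)), ?_, ?_⟩
  · have hne : Λ x ≠ 0 := fun h => by simp [h] at hpos
    simp only [shellIntegrand]
    rw [integral_const_mul, integral_rpow_mul_cexp_neg hs hpos, Complex.ofReal_sub,
      sub_eq_add_neg (σ : ℂ), Complex.cpow_add _ _ hne]
    ring
  · have e : ∫ u in Ioi (0 : ℝ), ‖shellIntegrand φ Λ s σ (x, u)‖ =
        ‖shellPart φ Λ x‖ * ‖Λ x ^ (σ : ℂ)‖ *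
          ((1 / (Λ x).re) ^ s * Real.Gamma s) := by
      rw [← Real.integral_rpow_mul_exp_neg_mul_Ioi hs hpos, ← integral_const_mul]
      refine setIntegral_congr_fun measurableSet_Ioi fun u hu => ?_
      simp only [shellIntegrand]
      rw [norm_mul, norm_mul, norm_ofReal_rpow_mul_cexp _ (le_of_lt hu)]
    have h1 : 1 ≤ ‖Λ x‖ := hm1.trans (Complex.re_le_norm _)
    have h2 : ‖Λ x‖ ≤ 2 * K := hnorm.trans (by nlinarith)
    have h3 : ‖Λ x ^ (σ : ℂ)‖ ≤ (2 * K) ^ |σ| := by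
      rw [Complex.norm_cpow_real]
      calc ‖Λ x‖ ^ σ ≤ ‖Λ x‖ ^ |σ| := Real.rpow_le_rpow_of_exponent_le h1 (le_abs_self σ)
        _ ≤ (2 * K) ^ |σ| := Real.rpow_le_rpow (by linarith) h2 (abs_nonneg σ)
    have h4 : (1 / (Λ x).re) ^ s ≤ 1 :=
      Real.rpow_le_one (by positivity) (by rw [div_le_one hpos]; exact hm1) hs.le
    have h5 := (Real.Gamma_pos_of_pos hs).le
    rw [e]
    calc ‖shellPart φ Λ x‖ * ‖Λ x ^ (σ : ℂ)‖ * ((1 / (Λ x).re) ^ s * Real.Gamma s)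
        ≤ ‖shellPart φ Λ x‖ * (2 * K) ^ |σ| * (1 * Real.Gamma s) := by gcongr
      _ = (2 * K) ^ |σ| * Real.Gamma s * ‖shellPart φ Λ x‖ := by ring

variable [MeasurableSpace E]

lemma measurable_dilationIntegrand (hφ : Measurable φ) (hΛ : Measurable Λ) (σ : ℝ) :
    Measurable (dilationIntegrand φ Λ σ) := by
  have hΛ' : Measurable fun y : E × ℝ => Λ y.1 := hΛ.comp measurable_fst
  have hre : Measurable fun y : E × ℝ => (Λ y.1).re := Complex.measurable_re.comp hΛ'
  refine Measurable.indicator ?_ ((measurableSet_le measurable_snd hre).inter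
    (measurableSet_le hre (measurable_snd.const_mul 2)))
  fun_prop

lemma measurable_shellPart (hφ : Measurable φ) (hΛ : Measurable Λ) :
    Measurable (shellPart φ Λ) := by
  have hre : Measurable fun y => (Λ y).re := Complex.measurable_re.comp hΛ
  exact hφ.indicator ((measurableSet_le measurable_const hre).inter
    (measurableSet_le hre measurable_const))

lemma measurable_shellIntegrand (hφ : Measurable φ) (hΛ : Measurable Λ) (s σ : ℝ) :
    Measurable (shellIntegrand φ Λ s σ) := by
  have := measurable_shellPart hφ hΛ
  unfold shellIntegrand
  fun_prop

lemma integrable_shellIntegrand {μ : Measure E} [SFinite μ] {s K : ℝ}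
    (hφ : Measurable φ) (hΛ : Measurable Λ) (hs : 0 < s) (hK : 1 ≤ K) (σ : ℝ)
    (hx : ∀ x, φ x ≠ 0 → 0 < (Λ x).re ∧ ‖Λ x‖ ≤ K * (Λ x).re)
    (hint : Integrable (shellPart φ Λ) μ) :
    Integrable (shellIntegrand φ Λ s σ) (μ.prod (volume.restrict (Ioi 0))) := by
  have hm := (measurable_shellIntegrand hφ hΛ s σ).aestronglyMeasurable
    (μ := μ.prod (volume.restrict (Ioi 0)))
  refine (integrable_prod_iff hm).2 ⟨Filter.Eventually.of_forall fun x =>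
    (shellIntegrand_fiber hs hK σ x (hx x)).1, ?_⟩
  refine (hint.norm.const_mul ((2 * K) ^ |σ| * Real.Gamma s)).mono' hm.norm.integral_prod_right'
    (Filter.Eventually.of_forall fun x => ?_)
  rw [Real.norm_of_nonneg (integral_nonneg fun _ => norm_nonneg _)]
  exact (shellIntegrand_fiber hs hK σ x (hx x)).2.2

end Integrands

section Dilation

variable {E : Type*} [NormedAddCommGroup E] [NormedSpace ℝ E] {φ Λ : E → ℂ} {d : ℝ}

/-- Rescaling by u frees the constraint of u. The Jacobian, φ, Λ^σ and du/u contribute u^dim, u^d,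
u^σ and u⁻¹, together u^(s-1). -/
lemma dilationIntegrand_smul (hhom : ∀ u : ℝ, 0 < u → ∀ x, φ (u • x) = ((u ^ d : ℝ) : ℂ) * φ x)
    (hlin : ∀ (u : ℝ) x, Λ (u • x) = u * Λ x) (σ : ℝ) {u : ℝ} (hu : 0 < u) (x : E) :
    ((u ^ finrank ℝ E : ℝ) : ℂ) * dilationIntegrand φ Λ σ (u • x, u) =
      shellIntegrand φ Λ (d + finrank ℝ E + σ) σ (x, u) := by
  have hmem : ((u • x, u) ∈ {y : E × ℝ | y.2 ≤ (Λ y.1).re ∧ (Λ y.1).re ≤ 2 * y.2}) ↔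
      x ∈ {x | 1 ≤ (Λ x).re ∧ (Λ x).re ≤ 2} := by
    simp only [mem_ofPred_eq, hlin, Complex.re_ofReal_mul]
    rw [le_mul_iff_one_le_right hu, mul_comm 2 u, mul_le_mul_iff_right₀ hu]
  rw [dilationIntegrand, shellIntegrand, shellPart]
  by_cases hx : x ∈ {x | 1 ≤ (Λ x).re ∧ (Λ x).re ≤ 2}
  · rw [indicator_of_mem (hmem.2 hx), indicator_of_mem hx]
    have h1 : u ^ (d + finrank ℝ E + σ - 1) = u ^ finrank ℝ E * u ^ d * u ^ σ * u⁻¹ := by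
      rw [Real.rpow_sub_one hu.ne', Real.rpow_add hu, Real.rpow_add hu, Real.rpow_natCast]
      ring
    have h2 : ((u : ℂ) * Λ x) ^ (σ : ℂ) = ((u ^ σ : ℝ) : ℂ) * Λ x ^ (σ : ℂ) := by
      rw [Complex.ofReal_cpow hu.le,
        mul_cpow_of_re_pos (by simpa using hu) (zero_lt_one.trans_le hx.1)]
    simp only [hhom u hu, hlin, h1, h2]
    rw [mul_comm (Λ x) u]
    push_cast
    ring
  · rw [indicator_of_notMem (fun h => hx (hmem.1 h)), indicator_of_notMem hx]
    simp

variable [MeasurableSpace E] [BorelSpace E] [FiniteDimensional ℝ E]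

lemma integral_dilationIntegrand_slice {μ : Measure E} [μ.IsAddHaarMeasure]
    (hhom : ∀ u : ℝ, 0 < u → ∀ x, φ (u • x) = ((u ^ d : ℝ) : ℂ) * φ x)
    (hlin : ∀ (u : ℝ) x, Λ (u • x) = u * Λ x) (σ : ℝ) {u : ℝ} (hu : 0 < u) :
    (Integrable (fun x => shellIntegrand φ Λ (d + finrank ℝ E + σ) σ (x, u)) μ →
      Integrable (fun x => dilationIntegrand φ Λ σ (x, u)) μ) ∧
    ∫ x, dilationIntegrand φ Λ σ (x, u) ∂μ =
      ∫ x, shellIntegrand φ Λ (d + finrank ℝ E + σ) σ (x, u) ∂μ ∧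
    ∫ x, ‖dilationIntegrand φ Λ σ (x, u)‖ ∂μ =
      ∫ x, ‖shellIntegrand φ Λ (d + finrank ℝ E + σ) σ (x, u)‖ ∂μ := by
  have hne : u ^ finrank ℝ E ≠ 0 := pow_ne_zero _ hu.ne'
  refine ⟨fun h => ?_, ?_, ?_⟩
  · rw [← integrable_comp_smul_iff μ _ hu.ne']
    refine (h.const_mul (((u ^ finrank ℝ E : ℝ) : ℂ)⁻¹)).congr
      (Filter.Eventually.of_forall fun x => ?_)
    simp only [← dilationIntegrand_smul hhom hlin σ hu]
    rw [inv_mul_cancel_left₀ (by exact_mod_cast hne)]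
  · simp only [← dilationIntegrand_smul hhom hlin σ hu]
    rw [integral_const_mul,
      Measure.integral_comp_smul_of_nonneg μ (fun x => dilationIntegrand φ Λ σ (x, u)) u
        (hR := hu.le), Complex.real_smul, ← mul_assoc, ← Complex.ofReal_mul, mul_inv_cancel₀ hne,
      Complex.ofReal_one, one_mul]
  · simp only [← dilationIntegrand_smul hhom hlin σ hu]
    simp only [norm_mul, Complex.norm_real, Real.norm_of_nonneg (pow_nonneg hu.le _)]
    rw [integral_const_mul,
      Measure.integral_comp_smul_of_nonneg μ (fun x => ‖dilationIntegrand φ Λ σ (x, u)‖) u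
        (hR := hu.le), smul_eq_mul, mul_inv_cancel_left₀ hne]

/-- Fubini on both sides of the rescaling. The shell exponent σ - s equals -(d + dim), so σ survives
on the right only in the gamma factor. Integrability is first shown for the shell integrand and then
transferred slice by slice. -/
lemma integral_exp_mul_cpow_eq_shell {μ : Measure E} [μ.IsAddHaarMeasure] {K σ : ℝ}
    (hφ : Measurable φ) (hΛ : Measurable Λ)
    (hhom : ∀ u : ℝ, 0 < u → ∀ x, φ (u • x) = ((u ^ d : ℝ) : ℂ) * φ x)
    (hlin : ∀ (u : ℝ) x, Λ (u • x) = u * Λ x) (hK : 1 ≤ K)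
    (hx : ∀ x, φ x ≠ 0 → 0 < (Λ x).re ∧ ‖Λ x‖ ≤ K * (Λ x).re)
    (hint : Integrable (shellPart φ Λ) μ) (hs : 0 < d + finrank ℝ E + σ) :
    Integrable (fun x => φ x * (Complex.exp (-Λ x) * Λ x ^ (σ : ℂ))) μ ∧
      ((Real.log 2 : ℝ) : ℂ) * ∫ x, φ x * (Complex.exp (-Λ x) * Λ x ^ (σ : ℂ)) ∂μ =
        Complex.Gamma ((d + finrank ℝ E + σ : ℝ) : ℂ) *
          ∫ x, shellPart φ Λ x * Λ x ^ ((-(d + finrank ℝ E) : ℝ) : ℂ) ∂μ := by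
  have hshell := integrable_shellIntegrand hφ hΛ hs hK σ hx hint
  have hpos : ∀ᵐ u ∂(volume.restrict (Ioi (0 : ℝ))), 0 < u :=
    ae_restrict_mem measurableSet_Ioi
  have hdil : Integrable (dilationIntegrand φ Λ σ) (μ.prod (volume.restrict (Ioi 0))) := by
    refine (integrable_prod_iff'
      (measurable_dilationIntegrand hφ hΛ σ).aestronglyMeasurable).2 ⟨?_, ?_⟩
    · filter_upwards [hshell.prod_left_ae, hpos] with u h hu
      exact (integral_dilationIntegrand_slice hhom hlin σ hu).1 h
    · refine hshell.integral_norm_prod_right.congr ?_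
      filter_upwards [hpos] with u hu
      exact (integral_dilationIntegrand_slice hhom hlin σ hu).2.2.symm
  have hfib : ∀ x, ∫ u in Ioi (0 : ℝ), dilationIntegrand φ Λ σ (x, u) =
      ((Real.log 2 : ℝ) : ℂ) * (φ x * (Complex.exp (-Λ x) * Λ x ^ (σ : ℂ))) := by
    intro x
    by_cases h0 : φ x = 0
    · have : ∀ u, dilationIntegrand φ Λ σ (x, u) = 0 := fun u => by
        simp [dilationIntegrand, indicator, h0]
      simp [this, h0]
    · exact dilationIntegrand_fiber (hx x h0).1 σ
  have hlog : ((Real.log 2 : ℝ) : ℂ) ≠ 0 := by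
    exact_mod_cast (Real.log_pos one_lt_two).ne'
  constructor
  · have h := hdil.integral_prod_left
    simp only [hfib] at h
    refine (h.const_mul (((Real.log 2 : ℝ) : ℂ)⁻¹)).congr
      (Filter.Eventually.of_forall fun x => ?_)
    simp only
    rw [inv_mul_cancel_left₀ hlog]
  · rw [← integral_const_mul, ← integral_const_mul]
    simp only [← hfib]
    rw [← integral_prod _ hdil, integral_prod_symm _ hdil]
    have h1 : ∫ u in Ioi (0 : ℝ), ∫ x, dilationIntegrand φ Λ σ (x, u) ∂μ =
        ∫ u in Ioi (0 : ℝ), ∫ x, shellIntegrand φ Λ (d + finrank ℝ E + σ) σ (x, u) ∂μ :=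
      setIntegral_congr_fun measurableSet_Ioi fun u hu =>
        (integral_dilationIntegrand_slice hhom hlin σ hu).2.1
    rw [h1, ← integral_prod_symm _ hshell, integral_prod _ hshell]
    refine integral_congr_ae (Filter.Eventually.of_forall fun x => ?_)
    simp only
    rw [(shellIntegrand_fiber hs hK σ x (hx x)).2.1]
    congr 4
    ring

/-- For `φ` homogeneous, `∫ φ e^{-Λ} Λ^σ` and `∫ φ e^{-Λ}` differ by a quotient of gamma values. -/
lemma integral_homogeneous_mul_cpow {μ : Measure E} [μ.IsAddHaarMeasure] {K σ : ℝ}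
    (hφ : Measurable φ) (hΛ : Measurable Λ)
    (hhom : ∀ u : ℝ, 0 < u → ∀ x, φ (u • x) = ((u ^ d : ℝ) : ℂ) * φ x)
    (hlin : ∀ (u : ℝ) x, Λ (u • x) = u * Λ x) (hK : 1 ≤ K)
    (hx : ∀ x, φ x ≠ 0 → 0 < (Λ x).re ∧ ‖Λ x‖ ≤ K * (Λ x).re)
    (hint : Integrable (fun x => φ x * Complex.exp (-Λ x)) μ)
    (hd : 0 < d + finrank ℝ E) (hs : 0 < d + finrank ℝ E + σ) :
    Integrable (fun x => φ x * (Complex.exp (-Λ x) * Λ x ^ (σ : ℂ))) μ ∧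
      Complex.Gamma ((d + finrank ℝ E : ℝ) : ℂ) *
        ∫ x, φ x * (Complex.exp (-Λ x) * Λ x ^ (σ : ℂ)) ∂μ =
      Complex.Gamma ((d + finrank ℝ E + σ : ℝ) : ℂ) * ∫ x, φ x * Complex.exp (-Λ x) ∂μ := by
  -- On the shell e^(-Re Λ) ≥ e^(-2).
  have hsh : Integrable (shellPart φ Λ) μ := by
    refine (hint.norm.const_mul (Real.exp 2)).mono'
      (measurable_shellPart hφ hΛ).aestronglyMeasurable (Filter.Eventually.of_forall fun x => ?_)
    by_cases hm : x ∈ {x | 1 ≤ (Λ x).re ∧ (Λ x).re ≤ 2}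
    · rw [shellPart, indicator_of_mem hm, norm_mul, Complex.norm_exp, mul_left_comm,
        ← Real.exp_add]
      refine le_mul_of_one_le_right (norm_nonneg _) (Real.one_le_exp ?_)
      rw [Complex.neg_re]
      linarith [hm.2]
    · rw [shellPart, indicator_of_notMem hm, norm_zero]
      positivity
  obtain ⟨h1, h2⟩ := integral_exp_mul_cpow_eq_shell hφ hΛ hhom hlin hK hx hsh hs
  -- The case σ = 0 evaluates the same shell integral, which is then eliminated.
  obtain ⟨-, h3⟩ := integral_exp_mul_cpow_eq_shell (σ := 0) hφ hΛ hhom hlin hK hx hsh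
    (by simpa using hd)
  simp only [add_zero, Complex.ofReal_zero, Complex.cpow_zero, mul_one] at h3
  have hlog : ((Real.log 2 : ℝ) : ℂ) ≠ 0 := by
    exact_mod_cast (Real.log_pos one_lt_two).ne'
  refine ⟨h1, mul_left_cancel₀ hlog ?_⟩
  rw [mul_left_comm, h2, mul_left_comm (((Real.log 2 : ℝ) : ℂ)), h3]
  ring

end Dilation

end Homogeneous

/-! ### The Whittaker kernel as a gamma-type integral. -/

section Kernel

open Set

lemma cpow_mul_exp_mul_whittakerW {z κ μ A : ℂ} {h σ : ℝ} (hh : 0 < h) (hz : 0 < z.re)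
    (h1 : μ - κ + 1 / 2 = (h : ℂ)) (h2 : μ + κ - 1 / 2 = (σ : ℂ)) (h3 : A + κ = (σ : ℂ)) :
    Complex.Gamma h * (z ^ A * Complex.exp (-(1 / 2) * z) * whittakerW κ μ z) =
      ∫ t in Ioi (0 : ℝ), ((t ^ (h - 1) : ℝ) : ℂ) *
        (Complex.exp (-(z + t)) * (z + t) ^ (σ : ℂ)) := by
  have hz0 : z ≠ 0 := by rintro rfl; exact lt_irrefl _ hz
  have hG : Complex.Gamma h ≠ 0 := by
    rw [Complex.Gamma_ofReal]
    exact_mod_cast (Real.Gamma_pos_of_pos hh).ne'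
  have h4 : μ - κ - 1 / 2 = ((h - 1 : ℝ) : ℂ) := by
    push_cast
    linear_combination h1
  have e1 : Complex.exp (-z) = Complex.exp (-(1 / 2) * z) * Complex.exp (-z / 2) := by
    rw [← Complex.exp_add]; congr 1; ring
  have e2 : z ^ (σ : ℂ) = z ^ A * z ^ κ := by rw [← Complex.cpow_add _ _ hz0, h3]
  have key : ∀ t ∈ Ioi (0 : ℝ), ((t ^ (h - 1) : ℝ) : ℂ) *
      (Complex.exp (-(z + t)) * (z + t) ^ (σ : ℂ)) =
      (z ^ A * z ^ κ * (Complex.exp (-(1 / 2) * z) * Complex.exp (-z / 2))) *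
      ((t : ℂ) ^ (μ - κ - 1 / 2) * Complex.exp (-(t : ℂ)) *
        (1 + (t : ℂ) / z) ^ (μ + κ - 1 / 2)) := by
    intro t ht
    have ht : 0 < t := ht
    -- Both factors of z (1 + t/z) lie in the right half-plane, so principal powers multiply.
    have hw : 0 < (1 + (t : ℂ) / z).re := by
      rw [Complex.add_re, Complex.one_re, Complex.div_re]
      simp only [Complex.ofReal_re, Complex.ofReal_im, zero_mul, zero_div, add_zero]
      have := Complex.normSq_nonneg z
      positivity
    have e3 : z + t = z * (1 + (t : ℂ) / z) := by field_simp
    rw [h4, h2, ← Complex.ofReal_cpow ht.le, ← e2, ← e1]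
    nth_rewrite 2 [e3]
    rw [mul_cpow_of_re_pos hz hw, neg_add, Complex.exp_add]
    ring
  rw [setIntegral_congr_fun measurableSet_Ioi key, integral_const_mul, whittakerW, h1]
  field_simp

end Kernel

/-! ### Assembly of the transform. -/

section Transform

open Set Module

variable {p N : ℕ}

/-- The homogeneous weight `|X|^{N/2 - (p+1)/2} t^{h-1}` on `X > 0`, `t > 0`. -/
def coneWeight (N p : ℕ) (h : ℝ) (y : (UpperIndex p → ℝ) × ℝ) : ℂ :=
  (posDefCone p).indicator
      (fun x => (((symMatrix x).det ^ ((N : ℝ) / 2 - ((p : ℝ) + 1) / 2) : ℝ) : ℂ)) y.1 *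
    (Ioi (0 : ℝ)).indicator (fun t => ((t ^ (h - 1) : ℝ) : ℂ)) y.2

/-- The linear form `tr ZX + t`. -/
def coneForm (Z : Matrix (Fin p) (Fin p) ℂ) (y : (UpperIndex p → ℝ) × ℝ) : ℂ :=
  (Z * toComplex (symMatrix y.1)).trace + y.2

lemma measurable_coneWeight (h : ℝ) : Measurable (coneWeight N p h) := by
  have h1 : Measurable fun x : UpperIndex p → ℝ => (symMatrix x).det :=
    continuous_symMatrix.matrix_det.measurable
  refine Measurable.mul (Measurable.comp (g := (posDefCone p).indicator _)
    (Measurable.indicator ?_ measurableSet_posDefCone) measurable_fst)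
    (Measurable.comp (g := (Ioi (0 : ℝ)).indicator _)
      (Measurable.indicator ?_ measurableSet_Ioi) measurable_snd) <;> fun_prop

lemma measurable_coneForm (Z : Matrix (Fin p) (Fin p) ℂ) : Measurable (coneForm Z) := by
  have : Continuous (coneForm Z) := by
    refine Continuous.add (Continuous.matrix_trace (continuous_const.matrix_mul
      (continuous_toComplex.comp (continuous_symMatrix.comp continuous_fst)))) ?_
    fun_prop
  exact this.measurable

lemma symMatrix_smul (u : ℝ) (x : UpperIndex p → ℝ) : symMatrix (u • x) = u • symMatrix x := by
  ext i j
  simp [symMatrix]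

lemma coneForm_smul (Z : Matrix (Fin p) (Fin p) ℂ) (u : ℝ) (y : (UpperIndex p → ℝ) × ℝ) :
    coneForm Z (u • y) = u * coneForm Z y := by
  have : toComplex (u • symMatrix y.1) = (u : ℂ) • toComplex (symMatrix y.1) := by
    ext i j
    simp [toComplex]
  rw [coneForm, coneForm, Prod.smul_fst, Prod.smul_snd, symMatrix_smul, this, Matrix.mul_smul,
    trace_smul]
  simp only [smul_eq_mul]
  push_cast
  ring

lemma smul_mem_posDefCone {u : ℝ} (hu : 0 < u) (x : UpperIndex p → ℝ) :
    u • x ∈ posDefCone p ↔ x ∈ posDefCone p := by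
  simp only [posDefCone, mem_ofPred_eq, symMatrix_smul]
  refine ⟨fun h => ?_, fun h => h.smul hu⟩
  have := h.smul (inv_pos.2 hu)
  rwa [inv_smul_smul₀ hu.ne'] at this

lemma coneWeight_smul (h : ℝ) {u : ℝ} (hu : 0 < u) (y : (UpperIndex p → ℝ) × ℝ) :
    coneWeight N p h (u • y) =
      ((u ^ ((p : ℝ) * ((N : ℝ) / 2 - ((p : ℝ) + 1) / 2) + (h - 1)) : ℝ) : ℂ) *
        coneWeight N p h y := by
  rw [coneWeight, coneWeight, Prod.smul_fst, Prod.smul_snd]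
  by_cases h1 : y.1 ∈ posDefCone p
  · by_cases h2 : y.2 ∈ Ioi (0 : ℝ)
    · have h2' : 0 < y.2 := h2
      have h3 : u • y.2 ∈ Ioi (0 : ℝ) := mul_pos hu h2'
      have hX : (symMatrix y.1).PosDef := h1
      rw [indicator_of_mem h1, indicator_of_mem h2, indicator_of_mem h3,
        indicator_of_mem ((smul_mem_posDefCone hu _).2 h1), symMatrix_smul, det_smul,
        Fintype.card_fin, smul_eq_mul, Real.mul_rpow (by positivity) hX.det_pos.le,
        Real.mul_rpow hu.le h2'.le, Real.rpow_add hu, Real.rpow_mul hu.le, Real.rpow_natCast]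
      push_cast
      ring
    · have h3 : u • y.2 ∉ Ioi (0 : ℝ) := fun h => h2 ((pos_iff_pos_of_mul_pos h).1 hu)
      rw [indicator_of_notMem h2, indicator_of_notMem h3]
      simp
  · rw [indicator_of_notMem h1, indicator_of_notMem (fun h => h1 ((smul_mem_posDefCone hu _).1 h))]
    simp

lemma finrank_coneSpace :
    (finrank ℝ ((UpperIndex p → ℝ) × ℝ) : ℝ) = (p : ℝ) * ((p : ℝ) + 1) / 2 + 1 := by
  have h : (Fintype.card (UpperIndex p) : ℝ) * 2 = (p : ℝ) * ((p : ℝ) + 1) := by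
    exact_mod_cast card_upperIndex p
  rw [finrank_prod, finrank_self, finrank_fintype_fun_eq_card]
  push_cast
  linarith

lemma coneForm_bound {Z : Matrix (Fin p) (Fin p) ℂ} (hZ : Accretive Z) :
    ∃ K : ℝ, 1 ≤ K ∧ ∀ (h : ℝ) (y : (UpperIndex p → ℝ) × ℝ), coneWeight N p h y ≠ 0 →
      0 < (coneForm Z y).re ∧ ‖coneForm Z y‖ ≤ K * (coneForm Z y).re := by
  obtain ⟨K, hK, hb⟩ := hZ.exists_norm_trace_le
  refine ⟨K, hK, fun h y hy => ?_⟩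
  obtain ⟨h1, h2⟩ := mul_ne_zero_iff.1 hy
  have hm : y.1 ∈ posDefCone p := mem_of_indicator_ne_zero h1
  have hX : (symMatrix y.1).PosDef := hm
  have hm' : y.2 ∈ Ioi (0 : ℝ) := mem_of_indicator_ne_zero h2
  have ht : 0 < y.2 := hm'
  have h3 := hZ.re_trace_nonneg hX.posSemidef
  have h4 := hb _ hX.posSemidef
  have h5 : (coneForm Z y).re = (Z * toComplex (symMatrix y.1)).trace.re + y.2 := by
    simp [coneForm]
  refine ⟨by linarith, ?_⟩
  have h6 : ‖coneForm Z y‖ ≤ ‖(Z * toComplex (symMatrix y.1)).trace‖ + y.2 := by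
    refine (norm_add_le _ _).trans ?_
    rw [Complex.norm_real, Real.norm_of_nonneg ht.le]
  rw [h5]
  nlinarith

lemma coneWeight_mul_exp (h : ℝ) (Z : Matrix (Fin p) (Fin p) ℂ) (y : (UpperIndex p → ℝ) × ℝ) :
    coneWeight N p h y * Complex.exp (-coneForm Z y) =
      (posDefCone p).indicator (fun x => laplaceIntegrand N Z (symMatrix x)) y.1 *
        (Ioi (0 : ℝ)).indicator
          (fun t : ℝ => ((t ^ (h - 1) : ℝ) : ℂ) * Complex.exp (-((1 : ℂ) * t))) y.2 := by
  rw [coneWeight, coneForm, neg_add, Complex.exp_add]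
  by_cases h1 : y.1 ∈ posDefCone p <;> by_cases h2 : y.2 ∈ Ioi (0 : ℝ) <;>
    simp only [indicator_of_mem, indicator_of_notMem, h1, h2, not_false_eq_true, laplaceIntegrand,
      zero_mul, mul_zero, one_mul]
  ring

lemma integrable_coneWeight_mul_exp (hN : p ≤ N) {h : ℝ} (hh : 0 < h)
    {Z : Matrix (Fin p) (Fin p) ℂ} (hZ : Accretive Z) :
    Integrable (fun y => coneWeight N p h y * Complex.exp (-coneForm Z y))
        ((volume : Measure (UpperIndex p → ℝ)).prod volume) ∧
      ∫ y, coneWeight N p h y * Complex.exp (-coneForm Z y)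
        ∂((volume : Measure (UpperIndex p → ℝ)).prod volume) =
          coneIntegral (laplaceIntegrand N Z) * Complex.Gamma h := by
  simp only [coneWeight_mul_exp]
  have h1 : 0 < (1 : ℂ).re := by simp
  constructor
  · exact Integrable.mul_prod ((integrable_indicator_iff measurableSet_posDefCone).2
      (coneIntegrable_laplaceIntegrand hN hZ)) ((integrable_indicator_iff measurableSet_Ioi).2
        (integrableOn_rpow_mul_cexp_neg hh h1))
  · rw [integral_prod_mul, integral_indicator measurableSet_posDefCone,
      integral_indicator measurableSet_Ioi, integral_rpow_mul_cexp_neg hh h1, Complex.one_cpow,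
      mul_one]
    rfl

lemma integral_fiber_eq_varmaKernel (hp : 1 ≤ p) (q : ℝ) {Z : Matrix (Fin p) (Fin p) ℂ}
    (hZ : Accretive Z) (x : UpperIndex p → ℝ) :
    ∫ t, coneWeight N p ((p : ℝ) / 2) (x, t) *
        (Complex.exp (-coneForm Z (x, t)) * coneForm Z (x, t) ^ ((q - 1 : ℝ) : ℂ)) =
      (posDefCone p).indicator (fun x => Complex.Gamma (((p : ℝ) / 2 : ℝ) : ℂ) *
        (varmaKernel q Z (symMatrix x) *
          (((symMatrix x).det ^ ((N : ℝ) / 2 - ((p : ℝ) + 1) / 2) : ℝ) : ℂ))) x := by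
  have hp0 : (0 : ℝ) < (p : ℝ) / 2 := by
    have : (0 : ℝ) < p := by exact_mod_cast hp
    linarith
  by_cases hx : x ∈ posDefCone p
  · have hX : (symMatrix x).PosDef := hx
    have hz := hZ.re_trace_pos hp hX
    -- The parameters give β - α + 1/2 = p/2 and β + α - 1/2 = q - 1; the exponent of the trace plus
    -- α is also q - 1.
    rw [indicator_of_mem hx, varmaKernel, etr, trace_smul, smul_eq_mul, ← mul_assoc,
      cpow_mul_exp_mul_whittakerW (h := (p : ℝ) / 2) (σ := q - 1) hp0 hz (by push_cast; ring)
        (by push_cast; ring) (by push_cast; ring), ← integral_mul_const,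
      ← integral_indicator measurableSet_Ioi]
    refine integral_congr_ae (Filter.Eventually.of_forall fun t => ?_)
    simp only [coneWeight, coneForm, indicator_of_mem hx]
    by_cases ht : t ∈ Ioi (0 : ℝ)
    · simp only [indicator_of_mem ht]
      ring
    · simp only [indicator_of_notMem ht]
      ring
  · rw [indicator_of_notMem hx]
    simp [coneWeight, hx]

/-- The M-Varma transform of a power of the determinant. -/
theorem varmaTransform_det_rpow (hp : 1 ≤ p) (hN : p ≤ N) {q : ℝ}
    (hq : 0 < (p : ℝ) * ((N : ℝ) + 1) / 2 + (q - 1)) {Z : Matrix (Fin p) (Fin p) ℂ}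
    (hZ : Accretive Z) :
    VarmaConvergent q
        (fun X => ((X.det ^ ((N : ℝ) / 2 - ((p : ℝ) + 1) / 2) : ℝ) : ℂ)) Z ∧
      varmaTransform q
        (fun X => ((X.det ^ ((N : ℝ) / 2 - ((p : ℝ) + 1) / 2) : ℝ) : ℂ)) Z =
        Complex.Gamma (((p : ℝ) * ((N : ℝ) + 1) / 2 + (q - 1) : ℝ) : ℂ) *
            multivariateGamma p ((N : ℂ) / 2) /
          Complex.Gamma (((p : ℝ) * ((N : ℝ) + 1) / 2 : ℝ) : ℂ) *
          detPow Z (-((N : ℂ) / 2)) := by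
  have hp0 : (0 : ℝ) < p := by exact_mod_cast hp
  have hh : (0 : ℝ) < (p : ℝ) / 2 := by linarith
  have hM : (0 : ℝ) < (p : ℝ) * ((N : ℝ) + 1) / 2 := by positivity
  have hG : ∀ s : ℝ, 0 < s → Complex.Gamma s ≠ 0 := fun s hs => by
    rw [Complex.Gamma_ofReal]
    exact_mod_cast (Real.Gamma_pos_of_pos hs).ne'
  -- Degree plus dimension: the p(p+1)/2 coordinates of X cancel the shift in the determinant
  -- exponent, and the variable t adds p/2.
  have hdim : (p : ℝ) * ((N : ℝ) / 2 - ((p : ℝ) + 1) / 2) + ((p : ℝ) / 2 - 1) +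
      (finrank ℝ ((UpperIndex p → ℝ) × ℝ) : ℝ) = (p : ℝ) * ((N : ℝ) + 1) / 2 := by
    rw [finrank_coneSpace]
    ring
  obtain ⟨K, hK, hb⟩ := coneForm_bound (N := N) hZ
  obtain ⟨hint, hval⟩ := integrable_coneWeight_mul_exp hN hh hZ
  obtain ⟨h1, h2⟩ := integral_homogeneous_mul_cpow (σ := q - 1)
    (μ := (volume : Measure (UpperIndex p → ℝ)).prod volume)
    (measurable_coneWeight (N := N) ((p : ℝ) / 2)) (measurable_coneForm Z)
    (fun u hu y => coneWeight_smul _ hu y) (coneForm_smul Z) hK (hb _) hint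
    (by rw [hdim]; exact hM) (by rw [hdim]; exact hq)
  rw [hdim, hval, coneIntegral_laplaceIntegrand hN hZ, integral_prod _ h1] at h2
  have h3 := h1.integral_prod_left
  simp only [integral_fiber_eq_varmaKernel hp q hZ] at h2 h3
  rw [integral_indicator measurableSet_posDefCone, integral_const_mul] at h2
  rw [integrable_indicator_iff measurableSet_posDefCone] at h3
  constructor
  · refine (h3.const_mul (Complex.Gamma (((p : ℝ) / 2 : ℝ) : ℂ))⁻¹).congr
      (Filter.Eventually.of_forall fun x => ?_)
    simp only
    rw [inv_mul_cancel_left₀ (hG _ hh)]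
  · rw [div_mul_eq_mul_div, eq_div_iff (hG _ hM)]
    refine mul_left_cancel₀ (hG _ hh) ?_
    rw [varmaTransform, coneIntegral]
    linear_combination h2

end Transform

end

end MVarma

theorem mainTheorem11 (p n : ℕ) (hp : 1 ≤ p) (hn : p + 1 ≤ n) (q : ℝ)
    (hq : 2 < 2 * q + (n : ℝ) * (p : ℝ))
    (Z : Matrix (Fin p) (Fin p) ℂ) (hZ : Z.IsSymm) (hU : (Z.map Complex.re).PosDef) :
    MVarma.VarmaConvergent q
        (fun X => ((X.det ^ (((n : ℝ) - 1) / 2 - ((p : ℝ) + 1) / 2) : ℝ) : ℂ)) Z ∧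
      MVarma.varmaTransform q
        (fun X => ((X.det ^ (((n : ℝ) - 1) / 2 - ((p : ℝ) + 1) / 2) : ℝ) : ℂ)) Z =
        Complex.Gamma ((2 * (q : ℂ) + (n : ℂ) * (p : ℂ) - 2) / 2) *
            MVarma.multivariateGamma p (((n : ℂ) - 1) / 2) /
          Complex.Gamma ((n : ℂ) * (p : ℂ) / 2) *
          MVarma.detPow Z (-(((n : ℂ) - 1) / 2)) := by
  -- The natural number N = n - 1 ≥ p is twice the gamma parameter, which makes the squaring
  -- argument apply.
  obtain ⟨N, rfl⟩ : ∃ N, n = N + 1 := ⟨n - 1, by omega⟩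
  have h := MVarma.varmaTransform_det_rpow (N := N) (q := q) hp (by omega)
    (by push_cast at hq; linarith) ⟨hZ, hU⟩
  have e1 : (2 * (q : ℂ) + ((N + 1 : ℕ) : ℂ) * (p : ℂ) - 2) / 2 =
      (((p : ℝ) * ((N : ℝ) + 1) / 2 + (q - 1) : ℝ) : ℂ) := by
    push_cast; ring
  have e2 : ((N + 1 : ℕ) : ℂ) * (p : ℂ) / 2 = (((p : ℝ) * ((N : ℝ) + 1) / 2 : ℝ) : ℂ) := by
    push_cast; ring
  have e3 : ((N + 1 : ℕ) : ℝ) - 1 = N := by push_cast; ring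
  have e4 : ((N + 1 : ℕ) : ℂ) - 1 = N := by push_cast; ring
  rw [e1, e2, e3, e4]
  exact h
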